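/- Let $q$ be a prime power, $A=\mathbb F_q[T]$, $k=\mathbb F_q(T)$, and let $k_\infty=\mathbb F_q((1/T))$ be the completion of $k$ at the place $\infty$, with absolute value $|\cdot|$. Let $f\in k_\infty$ be a quadratic unit, $f^2=af+b$ with $a\in A$, $d:=\deg_T a>0$, $b\in\mathbb F_q^{\ast}$, chosen so that $|f|>|f^{\ast}|$, where $f^{\ast}=a-f$ is its conjugate. Let $K=k(f)\subset k_\infty$ and let $\mathcal O_K$ be the integral closure of $A$ in $K$. Let $\infty_1$ be the place of $K$ induced by the inclusion $K\subset k_\infty$, let $A_{\infty_1}\subset K$ be the ring of functions regular at every place of $K$ other than $\infty_1$, and let $\Phi:\mathsf{Cl}_{A_{\infty_1}}\to\mathsf{Cl}_{\mathcal O_K}$ be the homomorphism of ideal class groups induced by $\mathfrak a\mapsto\mathfrak a\mathcal O_K$. Then there is exactly one other place $\infty_2\neq\infty_1$ of $K$ above $\infty$; $A_{\infty_1}$ is a Dedekind domain containing $f,fT,\dots,fT^{d-1}$; the ideal $\mathfrak a_{d-1}=(f,fT,\dots,fT^{d-1})$ of $A_{\infty_1}$ is nonzero and is equal to the maximal ideal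 $\mathfrak m_{\infty_2}\subset A_{\infty_1}$ of functions vanishing at $\infty_2$; the homomorphism $\Phi$ is surjective; and $$\operatorname{Ker}(\Phi)=\langle[\mathfrak a_{d-1}]\rangle=\langle[\mathfrak m_{\infty_2}]\rangle .$$ If moreover $\mathcal O_K=\mathbb F_q[T,f]$, or, more generally, if $f$ is a fundamental unit, that is, $\mathcal O_K^{\ast}=\{cf^n: c\in\mathbb F_q^{\ast},\,n\in\mathbb Z\}$, then this cyclic group $\operatorname{Ker}(\Phi)$ has order $d$. -/

import Mathlib

open Polynomial
open RatFunc (CompletionAtInfty inftyValuation inftyValued)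

noncomputable section

namespace QuadUnit

/-! ### Places of a field over a constant field -/

section Places

variable {K : Type*} [Field K]

/-- A place of `K` over the field of constants `F`, given by its valuation ring: a proper valuation
subring of `K` that contains the constants. -/
def IsPlace (F : Type*) [Field F] [Algebra F[X] K] (V : ValuationSubring K) : Prop :=
  V ≠ ⊤ ∧ ∀ c : F, algebraMap F[X] K (C c) ∈ V

/-- The ring of functions (elements of `K`) that are regular at every place different
from `P`. -/
def regularOutside (F : Type*) [Field F] [Algebra F[X] K] (P : ValuationSubring K) : Subring K :=
  ⨅ V : {V : ValuationSubring K // IsPlace F V ∧ V ≠ P}, V.1.toSubring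

theorem regularOutside_le {F : Type*} [Field F] [Algebra F[X] K] {P V : ValuationSubring K}
    (hV : IsPlace F V) (hne : V ≠ P) : regularOutside F P ≤ V.toSubring :=
  iInf_le (fun V : {V : ValuationSubring K // IsPlace F V ∧ V ≠ P} => V.1.toSubring) ⟨V, hV, hne⟩

/-- The ideal of functions vanishing at the place `V`, inside the ring of functions regular
outside of `P ≠ V`. -/
def vanishingIdeal {F : Type*} [Field F] [Algebra F[X] K] {P V : ValuationSubring K}
    (hV : IsPlace F V) (hne : V ≠ P) : Ideal (regularOutside F P) :=
  (IsLocalRing.maximalIdeal V).comap (Subring.inclusion (regularOutside_le hV hne))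

theorem mem_vanishingIdeal {F : Type*} [Field F] [Algebra F[X] K] {P V : ValuationSubring K}
    (hV : IsPlace F V) (hne : V ≠ P) (x : regularOutside F P) :
    x ∈ vanishingIdeal hV hne ↔ V.valuation (x : K) < 1 := by
  rw [vanishingIdeal, Ideal.mem_comap]
  exact ValuationSubring.valuation_lt_one_iff V ⟨x, regularOutside_le hV hne x.2⟩

theorem regularOutside_le_integralClosure {F : Type*} [Field F] [Algebra F[X] K]
    {P : ValuationSubring K} (hT : algebraMap F[X] K X ∉ P) :
    regularOutside F P ≤ (integralClosure F[X] K).toSubring := by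
  intro x hx
  have key : x ∈ (integralClosure (Subring.closure (Set.range (algebraMap F[X] K))) K).toSubring := by
    rw [← iInf_valuationSubring_superset, Subring.mem_iInf]
    rintro ⟨V, hV⟩
    by_cases htop : V = ⊤
    · subst htop
      exact ValuationSubring.mem_top x
    · refine regularOutside_le (F := F) ⟨htop, fun c => hV ⟨_, rfl⟩⟩ ?_ hx
      rintro rfl
      exact hT (hV ⟨X, rfl⟩)
  obtain ⟨r, hr, hrx⟩ := key
  have hcl : Subring.closure (Set.range (algebraMap F[X] K)) = (algebraMap F[X] K).range := by
    rw [← RingHom.coe_range, Subring.closure_eq]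
  have hlift : r.map (algebraMap (Subring.closure (Set.range (algebraMap F[X] K))) K)
      ∈ Polynomial.lifts (algebraMap F[X] K) := by
    rw [Polynomial.lifts_iff_coeff_lifts]
    intro n
    rw [Polynomial.coeff_map]
    exact hcl.le (r.coeff n).2
  obtain ⟨s, hs, -, hsm⟩ := Polynomial.lifts_and_degree_eq_and_monic hlift (hr.map _)
  refine ⟨s, hsm, ?_⟩
  rw [← Polynomial.eval_map, hs, Polynomial.eval_map]
  exact hrx

end Places

/-! ### The field `K = k(f)` inside `k_∞` and its rings -/

variable {F : Type*} [Field F] [DecidableEq (RatFunc F)]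

instance : Algebra F[X] (CompletionAtInfty F) :=
  ((algebraMap (RatFunc F) (CompletionAtInfty F)).comp (algebraMap F[X] (RatFunc F))).toAlgebra

instance : IsScalarTower F[X] (RatFunc F) (CompletionAtInfty F) :=
  IsScalarTower.of_algebraMap_eq fun _ => rfl

/-- `K = k(f) ⊆ k_∞`, where `k = F(T)`. -/
abbrev fieldK (f : CompletionAtInfty F) : IntermediateField (RatFunc F) (CompletionAtInfty F) :=
  IntermediateField.adjoin (RatFunc F) {f}

/-- `f` as an element of `K = k(f)`. -/
abbrev gen (f : CompletionAtInfty F) : fieldK f :=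
  IntermediateField.AdjoinSimple.gen (RatFunc F) f

/-- `T` as an element of `K`. -/
abbrev varT (f : CompletionAtInfty F) : fieldK f := algebraMap F[X] (fieldK f) X

/-- The place `V` of `K` lies over the place `∞` of `k = F(T)`. -/
def LiesOverInfty {f : CompletionAtInfty F} (V : ValuationSubring (fieldK f)) : Prop :=
  V.comap (algebraMap (RatFunc F) (fieldK f)) = (inftyValuation F).valuationSubring

/-- The place `∞₁` of `K`, induced by the inclusion `K ⊆ k_∞`. -/
def infty₁ (f : CompletionAtInfty F) : ValuationSubring (fieldK f) :=
  (Valued.v : Valuation (CompletionAtInfty F) _).valuationSubring.comap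
    (algebraMap (fieldK f) (CompletionAtInfty F))

/-- `A_{∞₁}`: the functions in `K` regular outside of `∞₁`. -/
abbrev A₁ (f : CompletionAtInfty F) : Subring (fieldK f) := regularOutside F (infty₁ f)

/-- `O_K`: the integral closure of `A = F[T]` in `K`. -/
abbrev OK (f : CompletionAtInfty F) : Subalgebra F[X] (fieldK f) :=
  FunctionField.ringOfIntegers F (fieldK f)

theorem valued_coe (x : RatFunc F) :
    Valued.v (algebraMap (RatFunc F) (CompletionAtInfty F) x) = inftyValuation F x :=
  letI := inftyValued F
  Valued.extensionValuation_apply_coe x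

theorem varT_notMem_infty₁ (f : CompletionAtInfty F) : varT f ∉ infty₁ f := by
  intro h
  have h1 : Valued.v (algebraMap (RatFunc F) (CompletionAtInfty F) RatFunc.X)
      ≤ (1 : WithZero (Multiplicative ℤ)) := by
    rw [← RatFunc.algebraMap_X]
    exact h
  rw [valued_coe, inftyValuation.X] at h1
  exact absurd h1 (by decide)

theorem A₁_le_OK (f : CompletionAtInfty F) : A₁ f ≤ (OK f).toSubring :=
  regularOutside_le_integralClosure (varT_notMem_infty₁ f)

instance (f : CompletionAtInfty F) : Algebra (A₁ f) (OK f) :=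
  (Subring.inclusion (A₁_le_OK f)).toAlgebra

theorem algebraMap_A₁_OK (f : CompletionAtInfty F) (x : A₁ f) :
    ((algebraMap (A₁ f) (OK f) x : OK f) : fieldK f) = x := rfl

instance (f : CompletionAtInfty F) : Module.IsTorsionFree (A₁ f) (OK f) := by
  rw [Module.isTorsionFree_iff_algebraMap_injective]
  exact Subring.inclusion_injective (A₁_le_OK f)

/-- The homomorphism `Cl(A_{∞₁}) → Cl(O_K)` induced by `𝔞 ↦ 𝔞 O_K`. -/
def inflation (f : CompletionAtInfty F) : ClassGroup (A₁ f) →* ClassGroup (OK f) :=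
  ClassGroup.extendedHom (A₁ f) (OK f)

/-- The ideal `𝔞_j = (f, fT, …, fT^j)` of `A_{∞₁}`. -/
def idealA (f : CompletionAtInfty F) (j : ℕ) : Ideal (A₁ f) :=
  Ideal.span {x : A₁ f | ∃ i ≤ j, (x : fieldK f) = gen f * varT f ^ i}

/-- Every unit of `O_K` is of the form `c f ^ n` with `c` a nonzero constant and `n ∈ ℤ`. -/
def IsFundamental (f : CompletionAtInfty F) : Prop :=
  ∀ u : (OK f)ˣ, ∃ (c : F) (n : ℤ), c ≠ 0 ∧
    ((u : OK f) : fieldK f) = algebraMap F[X] (fieldK f) (C c) * gen f ^ n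

end QuadUnit

end

open QuadUnit

/-! ### Dedekind domains from degree functions -/

section Degree

variable {F A : Type*} [Field F] [CommRing A] [IsDomain A] [Algebra F A] {deg : A → ℕ}

/-! Since `f` is integral over `F[T]` and `f(a - f) = -b`, it is a unit of `O_K`. As `|f| = |a| ≠
1`, it is not in `k`, so `K/k` is quadratic with conjugation `σ`, and `∞₂` is the conjugate of `∞₁`.
The divisor of `f` is `d(∞₂ - ∞₁)`. What follows needs only the data collected in `SplitUnit`.

`A_{∞₁}` consists of the elements of `O_K` regular at `∞₂`. It is integrally closed as an
intersection of valuation rings. The pole order at `∞₁` is a degree function with residue field `F`,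
so quotients by nonzero principal ideals are finite over `F`, which makes the ring Dedekind.

A high power of `f` cancels any pole at `∞₂`, so `O_K = A_{∞₁}[1/f]`, and `𝔪_{∞₂}` is the only prime
containing `f`. Inverting `f` is therefore surjective on class groups and kills exactly the powers
of `[𝔪_{∞₂}]` (`ClassGroup.ker_extendedHom_of_away`). For `x ∈ 𝔪_{∞₂}`, removing from `x/f` its
polar part at `∞₂`, a polynomial in `T` of degree below `d`, writes `x` through the `f T^i`
(`span_eq_vanishingIdeal`).

Finally `𝔪_{∞₂}^d = (f)`. A generator of any power `𝔪_{∞₂}^n` is a unit of `O_K`; if it equals `c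
f^j`, comparing orders at `∞₂` gives `d ∣ n`. -/

theorem finite_quotient_span_singleton_of_degree
    (hmul : ∀ x y : A, x ≠ 0 → y ≠ 0 → deg (x * y) = deg x + deg y)
    (hred : ∀ x y : A, x ≠ 0 → y ≠ 0 → deg x = deg y →
      ∃ c : F, x - c • y = 0 ∨ deg (x - c • y) < deg x)
    {x : A} (hx : x ≠ 0) : Module.Finite F (A ⧸ Ideal.span {x}) := by
  classical
  have h1 : deg 1 = 0 := by simpa using hmul 1 1 one_ne_zero one_ne_zero
  have hpow (k : ℕ) : deg (x ^ k) = k * deg x := by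
    induction k with
    | zero => simpa using h1
    | succ k ih => rw [pow_succ, hmul _ _ (pow_ne_zero k hx) hx, ih]; ring
  rcases Nat.eq_zero_or_pos (deg x) with hn | hn
  -- No degree lies below 0, so reducing `x` against `1` leaves nothing: `x` is a scalar, hence a
  -- unit.
  · obtain ⟨c, hc⟩ := hred x 1 hx one_ne_zero (hn.trans h1.symm)
    have hxc : x = algebraMap F A c := by
      rw [Algebra.algebraMap_eq_smul_one, ← sub_eq_zero]
      exact hc.resolve_right (by omega)
    have hc0 : c ≠ 0 := fun h => hx (by rw [hxc, h, map_zero])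
    have htop : Ideal.span {x} = (⊤ : Ideal A) := by
      rw [Ideal.span_singleton_eq_top, hxc]
      exact (IsUnit.mk0 c hc0).map _
    rw [htop]
    have : Subsingleton (A ⧸ (⊤ : Ideal A)) := Ideal.Quotient.subsingleton_iff.mpr rfl
    infer_instance
  -- `y r` has least degree among elements of degree `r` modulo `deg x` (the value 0 for an empty
  -- class is harmless). Every `z` has the degree of some `x ^ k * y r`, so a scalar multiple of it
  -- lowers the degree; modulo `x` only `k = 0` survives. Hence the images of the `y r` span.
  · have hmin (r : ℕ) : ∃ y : A, (∃ z : A, z ≠ 0 ∧ deg z % deg x = r) → y ≠ 0 ∧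
        deg y % deg x = r ∧ ∀ z : A, z ≠ 0 → deg z % deg x = r → deg y ≤ deg z := by
      by_cases h : ∃ z : A, z ≠ 0 ∧ deg z % deg x = r
      · have hex : ∃ m, ∃ z : A, (z ≠ 0 ∧ deg z % deg x = r) ∧ deg z = m := by
          obtain ⟨z, hz⟩ := h
          exact ⟨_, z, hz, rfl⟩
        obtain ⟨y, hy, hym⟩ := Nat.find_spec hex
        refine ⟨y, fun _ => ⟨hy.1, hy.2, fun z hz hzr => ?_⟩⟩
        rw [hym]
        exact Nat.find_min' hex ⟨z, ⟨hz, hzr⟩, rfl⟩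
      · exact ⟨0, fun h' => absurd h' h⟩
    choose y hy using hmin
    let q : A →ₗ[F] A ⧸ Ideal.span {x} := (Ideal.Quotient.mkₐ F (Ideal.span {x})).toLinearMap
    have hqx (z : A) : q (x * z) = 0 :=
      Ideal.Quotient.eq_zero_iff_mem.mpr (Ideal.mul_mem_right _ _ (Ideal.mem_span_singleton_self x))
    have key (m : ℕ) : ∀ z : A, deg z = m →
        q z ∈ Submodule.span F (((Finset.range (deg x)).image fun r => q (y r) : Finset _) :
          Set (A ⧸ Ideal.span {x})) := by
      induction m using Nat.strong_induction_on with
      | _ m ih =>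
        intro z hzm
        by_cases hz : z = 0
        · rw [hz, map_zero]; exact zero_mem _
        obtain ⟨hy0, hyr, hyle⟩ := hy (deg z % deg x) ⟨z, hz, rfl⟩
        have hle := hyle z hz rfl
        obtain ⟨k, hk⟩ := (Nat.modEq_iff_dvd' hle).mp hyr
        have hw0 : x ^ k * y (deg z % deg x) ≠ 0 := mul_ne_zero (pow_ne_zero _ hx) hy0
        have hdw : deg z = deg (x ^ k * y (deg z % deg x)) := by
          rw [hmul _ _ (pow_ne_zero _ hx) hy0, hpow, mul_comm k]
          omega
        obtain ⟨c, hc⟩ := hred z _ hz hw0 hdw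
        have hw : q (c • (x ^ k * y (deg z % deg x))) ∈ Submodule.span F
            (((Finset.range (deg x)).image fun r => q (y r) : Finset _) :
              Set (A ⧸ Ideal.span {x})) := by
          rw [map_smul]
          refine Submodule.smul_mem _ _ ?_
          rcases k with _ | k
          · rw [pow_zero, one_mul]
            refine Submodule.subset_span (Finset.mem_coe.mpr (Finset.mem_image.mpr
              ⟨_, Finset.mem_range.mpr (Nat.mod_lt _ hn), rfl⟩))
          · rw [pow_succ', mul_assoc, hqx]
            exact zero_mem _
        rw [← sub_add_cancel z (c • (x ^ k * y (deg z % deg x))), map_add]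
        refine add_mem ?_ hw
        rcases hc with hc | hc
        · rw [hc, map_zero]; exact zero_mem _
        · exact ih _ (hzm ▸ hc) _ rfl
    refine ⟨⟨(Finset.range (deg x)).image fun r => q (y r), eq_top_iff.mpr fun z _ => ?_⟩⟩
    obtain ⟨z, rfl⟩ := Ideal.Quotient.mk_surjective z
    exact key _ z rfl

end Degree

/-- A nonzero ideal containing `x` is finitely generated modulo `x`, hence finitely generated. For a
nonzero prime `P`, `A ⧸ P` is a domain finite over `F`, hence a field. -/
theorem isDedekindDomain_of_finite_quotient {F A : Type*} [Field F] [CommRing A] [IsDomain A]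
    [Algebra F A] [IsIntegrallyClosed A]
    (hfin : ∀ x : A, x ≠ 0 → Module.Finite F (A ⧸ Ideal.span {x})) : IsDedekindDomain A := by
  have hN : IsNoetherianRing A := by
    refine ⟨fun I => ?_⟩
    by_cases hI : I = ⊥
    · rw [hI]; exact Submodule.fg_bot
    obtain ⟨x, hxI, hx⟩ := Submodule.exists_mem_ne_zero_of_ne_bot hI
    have := hfin x hx
    have hNq : IsNoetherian A (A ⧸ Ideal.span {x}) :=
      isNoetherian_of_tower F inferInstance
    refine Submodule.fg_of_fg_map_of_fg_inf_ker (Ideal.span {x}).mkQ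
      (hNq.noetherian _) ?_
    rw [Submodule.ker_mkQ, inf_eq_right.mpr ((Ideal.span_singleton_le_iff_mem I).mpr hxI)]
    exact ⟨{x}, by simp [Ideal.span]⟩
  have hD : Ring.DimensionLEOne A := by
    refine ⟨fun {P} hP0 hP => ?_⟩
    obtain ⟨x, hxP, hx⟩ := Submodule.exists_mem_ne_zero_of_ne_bot hP0
    have := hfin x hx
    have hle := (Ideal.span_singleton_le_iff_mem P).mpr hxP
    have : Module.Finite F (A ⧸ P) := Module.Finite.of_surjective
      (Ideal.Quotient.factorₐ F hle).toLinearMap (Ideal.Quotient.factor_surjective hle)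
    refine Ideal.Quotient.maximal_of_isField P ?_
    exact isField_of_isIntegral_of_isField' (Field.toIsField F)
  exact { }

/-! ### Class groups and inverting one element -/

namespace ClassGroup

open scoped nonZeroDivisors

variable (A B : Type*) [CommRing A] [CommRing B] [Algebra A B] [Module.IsTorsionFree A B]
  [IsDedekindDomain A] [IsDedekindDomain B]

/-- Every ideal of a localization is the extension of its contraction. -/
theorem extendedHom_surjective_of_isLocalization (M : Submonoid A) [IsLocalization M B] :
    Function.Surjective (extendedHom A B) := by
  intro c
  obtain ⟨J, rfl⟩ := mk0_surjective c
  have hmap := IsLocalization.map_under M B J.1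
  have hne : J.1.under A ∈ (Ideal A)⁰ := by
    rw [mem_nonZeroDivisors_iff_ne_zero]
    intro h
    rw [h] at hmap
    exact mem_nonZeroDivisors_iff_ne_zero.mp J.2 (hmap.symm.trans Ideal.map_bot)
  refine ⟨mk0 ⟨_, hne⟩, ?_⟩
  rw [extendedHom_mk0]
  exact congrArg mk0 (Subtype.ext hmap)

variable {A}

/-- Each prime factor of `J` contains `J`, hence `s`, hence is `P`. -/
theorem exists_eq_pow_of_pow_mem {s : A} {P J : Ideal A}
    (huniq : ∀ Q : Ideal A, Q.IsPrime → s ∈ Q → Q = P) (hs : s ≠ 0) {n : ℕ} (hJ : s ^ n ∈ J) :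
    ∃ k, J = P ^ k := by
  have hJ0 : J ≠ 0 := fun h => pow_ne_zero n hs (by rwa [h] at hJ)
  have hall : ∀ Q ∈ UniqueFactorizationMonoid.normalizedFactors J, Q = P := by
    intro Q hQ
    have hQp := Ideal.isPrime_of_prime (UniqueFactorizationMonoid.prime_of_normalized_factor Q hQ)
    refine huniq Q hQp (hQp.mem_of_pow_mem n ?_)
    exact Ideal.dvd_iff_le.mp (UniqueFactorizationMonoid.dvd_of_mem_normalizedFactors hQ) hJ
  refine ⟨(UniqueFactorizationMonoid.normalizedFactors J).card, ?_⟩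
  conv_lhs => rw [← associated_iff_eq.mp (UniqueFactorizationMonoid.prod_normalizedFactors hJ0)]
  rw [Multiset.eq_replicate_card.mpr hall, Multiset.prod_replicate, Multiset.card_replicate]

/-- If `I` becomes principal, clearing the denominator of a generator gives `x ∈ I` that still
generates `IB`. Then `(x) = IJ` with `JB = B`, so `J` contains a power of `s` and is some `P ^ k`;
thus `[I] = [P]⁻ᵏ`. Conversely `PB` contains the unit `s`. -/
theorem ker_extendedHom_of_away {s : A} [IsLocalization.Away s B] {P : Ideal A}
    (hP : P ∈ (Ideal A)⁰) (hsP : s ∈ P)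
    (huniq : ∀ Q : Ideal A, Q.IsPrime → s ∈ Q → Q = P) (hs : s ≠ 0) :
    (extendedHom A B).ker = Subgroup.zpowers (mk0 ⟨P, hP⟩) := by
  have hinj : Function.Injective (algebraMap A B) := FaithfulSMul.algebraMap_injective A B
  apply le_antisymm
  · intro c hc
    obtain ⟨I, rfl⟩ := mk0_surjective c
    rw [MonoidHom.mem_ker, extendedHom_mk0, mk0_eq_one_iff] at hc
    obtain ⟨g, hg⟩ := hc
    replace hg : I.1.map (algebraMap A B) = Ideal.span {g} := hg
    have hgmem : g ∈ I.1.map (algebraMap A B) := hg ▸ Ideal.mem_span_singleton_self g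
    obtain ⟨⟨x, t⟩, hxt⟩ := (IsLocalization.mem_map_algebraMap_iff (.powers s) B).mp hgmem
    replace hxt : g * algebraMap A B t = algebraMap A B x := hxt
    have hspan : (Ideal.span {(x : A)}).map (algebraMap A B) = I.1.map (algebraMap A B) := by
      rw [Ideal.map_span, Set.image_singleton, ← hxt, hg]
      exact Ideal.span_singleton_mul_right_unit (IsLocalization.map_units B t) g
    obtain ⟨J, hJ⟩ := Ideal.dvd_iff_le.mpr ((Ideal.span_singleton_le_iff_mem I.1).mpr x.2)
    have hI0 : I.1.map (algebraMap A B) ≠ 0 :=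
      mem_nonZeroDivisors_iff_ne_zero.mp (extendedIdeal A B I).2
    have hJtop : J.map (algebraMap A B) = 1 := by
      rw [hJ, Ideal.map_mul] at hspan
      exact mul_left_cancel₀ hI0 (hspan.trans (mul_one _).symm)
    have h1 : (1 : B) ∈ J.map (algebraMap A B) := by rw [hJtop]; simp
    obtain ⟨⟨y, ⟨_, n, rfl⟩⟩, hy⟩ := (IsLocalization.mem_map_algebraMap_iff (.powers s) B).mp h1
    have hsJ : s ^ n ∈ J := by
      rw [one_mul] at hy
      have hy' : s ^ n = y := hinj hy
      exact hy' ▸ y.2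
    obtain ⟨k, rfl⟩ := exists_eq_pow_of_pow_mem huniq hs hsJ
    have hx1 : mk0 (I * ⟨P, hP⟩ ^ k) = 1 := by
      rw [mk0_eq_one_iff]
      exact ⟨⟨x, hJ.symm⟩⟩
    rw [map_mul, map_pow] at hx1
    rw [eq_inv_of_mul_eq_one_left hx1]
    exact inv_mem (pow_mem (Subgroup.mem_zpowers _) k)
  · rw [Subgroup.zpowers_le, MonoidHom.mem_ker, extendedHom_mk0, mk0_eq_one_iff]
    have : P.map (algebraMap A B) = ⊤ :=
      Ideal.eq_top_of_isUnit_mem _ (Ideal.mem_map_of_mem _ hsP)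
        (IsLocalization.Away.algebraMap_isUnit s)
    exact this ▸ ⟨⟨1, by simp⟩⟩

end ClassGroup

/-! ### Rings of functions with two places at infinity -/

namespace QuadUnit

open WithZero
open scoped nonZeroDivisors

theorem mem_valuationSubring_of_isIntegralElem {R K : Type*} [CommRing R] [Field K] (φ : R →+* K)
    {V : ValuationSubring K} (h : ∀ r, φ r ∈ V) {x : K} (hx : φ.IsIntegralElem x) : x ∈ V := by
  obtain ⟨p, hp, hpx⟩ := hx
  have hint : IsIntegral V x := by
    refine ⟨p.map (φ.codRestrict V.toSubring h), hp.map _, ?_⟩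
    rw [eval₂_map]
    exact hpx
  obtain ⟨y, rfl⟩ := IsIntegrallyClosed.isIntegral_iff.mp hint
  exact y.2

section Polynomial

variable {F K : Type*} [Field F] [Field K] [Algebra F[X] K]

theorem IsPlace.algebraMap_mem {V : ValuationSubring K} (hV : IsPlace F V)
    (hT : algebraMap F[X] K X ∈ V) (p : F[X]) : algebraMap F[X] K p ∈ V := by
  induction p using Polynomial.induction_on' with
  | add p q hp hq => rw [map_add]; exact add_mem hp hq
  | monomial n c =>
    rw [← C_mul_X_pow_eq_monomial, map_mul, map_pow]
    exact mul_mem (hV.2 c) (pow_mem hT n)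

end Polynomial

/-- The field `K` over the constants `F` has exactly two places at infinity, given by the
valuations `v₁` and `v₂`, both of degree one and unramified, and `g` is a unit of the integral
closure of `F[X]` with a pole of order `d` at `v₁` and a zero of order `d` at `v₂`. -/
structure SplitUnit (F : Type*) {K : Type*} [Field F] [Field K] [Algebra F[X] K]
    (v₁ v₂ : Valuation K ℤᵐ⁰) (g : K) (d : ℕ) : Prop where
  pos : 0 < d
  poly₁ : ∀ p : F[X], p ≠ 0 → v₁ (algebraMap F[X] K p) = exp (p.natDegree : ℤ)
  poly₂ : ∀ p : F[X], p ≠ 0 → v₂ (algebraMap F[X] K p) = exp (p.natDegree : ℤ)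
  gen₁ : v₁ g = exp (d : ℤ)
  gen₂ : v₂ g = exp (-d : ℤ)
  residue₁ : ∀ z, v₁ z = 1 → ∃ c : F, v₁ (z - algebraMap F[X] K (C c)) < 1
  residue₂ : ∀ z, v₂ z = 1 → ∃ c : F, v₂ (z - algebraMap F[X] K (C c)) < 1
  isIntegral_gen : IsIntegral F[X] g
  isIntegral_gen_inv : IsIntegral F[X] g⁻¹
  one_le_mul : ∀ x : K, IsIntegral F[X] x → x ≠ 0 → 1 ≤ v₁ x * v₂ x
  exists_isIntegral_mul : ∀ x : K, ∃ y : K, IsIntegral F[X] y ∧ y ≠ 0 ∧ IsIntegral F[X] (y * x)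
  eq_or_eq : ∀ V : ValuationSubring K, IsPlace F V → algebraMap F[X] K X ∉ V →
    V = v₁.valuationSubring ∨ V = v₂.valuationSubring

namespace SplitUnit

variable {F K : Type*} [Field F] [Field K] [Algebra F[X] K] {v₁ v₂ : Valuation K ℤᵐ⁰} {g : K}
  {d : ℕ} (h : SplitUnit F v₁ v₂ g d)

include h

theorem gen_ne_zero : g ≠ 0 := by
  rintro rfl
  exact exp_ne_zero (h.gen₁.symm.trans (map_zero _))

theorem const₁ (c : F) (hc : c ≠ 0) : v₁ (algebraMap F[X] K (C c)) = 1 := by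
  simpa using h.poly₁ (C c) (C_ne_zero.mpr hc)

theorem const₂ (c : F) (hc : c ≠ 0) : v₂ (algebraMap F[X] K (C c)) = 1 := by
  simpa using h.poly₂ (C c) (C_ne_zero.mpr hc)

theorem var₁ : v₁ (algebraMap F[X] K X) = exp 1 := by
  simpa using h.poly₁ X X_ne_zero

theorem var₂ : v₂ (algebraMap F[X] K X) = exp 1 := by
  simpa using h.poly₂ X X_ne_zero

theorem const_le₁ (c : F) : v₁ (algebraMap F[X] K (C c)) ≤ 1 := by
  by_cases hc : c = 0
  · simp [hc]
  · exact (h.const₁ c hc).le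

theorem const_le₂ (c : F) : v₂ (algebraMap F[X] K (C c)) ≤ 1 := by
  by_cases hc : c = 0
  · simp [hc]
  · exact (h.const₂ c hc).le

theorem isPlace₁ : IsPlace F v₁.valuationSubring := by
  refine ⟨fun htop => ?_, h.const_le₁⟩
  have hT : algebraMap F[X] K X ∈ v₁.valuationSubring := htop ▸ ValuationSubring.mem_top _
  rw [Valuation.mem_valuationSubring_iff, h.var₁] at hT
  exact absurd hT (by decide)

theorem isPlace₂ : IsPlace F v₂.valuationSubring := by
  refine ⟨fun htop => ?_, h.const_le₂⟩
  have hT : algebraMap F[X] K X ∈ v₂.valuationSubring := htop ▸ ValuationSubring.mem_top _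
  rw [Valuation.mem_valuationSubring_iff, h.var₂] at hT
  exact absurd hT (by decide)

theorem valuationSubring_ne : v₂.valuationSubring ≠ v₁.valuationSubring := by
  intro heq
  have hg : g ∈ v₂.valuationSubring := by
    rw [Valuation.mem_valuationSubring_iff, h.gen₂, ← exp_zero, exp_le_exp]
    omega
  rw [heq, Valuation.mem_valuationSubring_iff, h.gen₁, ← exp_zero, exp_le_exp] at hg
  have := h.pos
  omega

/-- A place regular at `T` contains `F[T]`, hence everything integral over it; the only other places
are those of `v₁` and `v₂`. -/
theorem mem_regularOutside_iff {x : K} : x ∈ regularOutside F v₁.valuationSubring ↔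
    IsIntegral F[X] x ∧ v₂ x ≤ 1 := by
  constructor
  · intro hx
    refine ⟨regularOutside_le_integralClosure ?_ hx,
      regularOutside_le h.isPlace₂ h.valuationSubring_ne hx⟩
    rw [Valuation.mem_valuationSubring_iff, h.var₁]
    decide
  · rintro ⟨hx, hx₂⟩
    rw [regularOutside, Subring.mem_iInf]
    rintro ⟨V, hV, hne⟩
    by_cases hT : algebraMap F[X] K X ∈ V
    · exact mem_valuationSubring_of_isIntegralElem _ (hV.algebraMap_mem hT) hx
    · rcases h.eq_or_eq V hV hT with rfl | rfl
      · exact absurd rfl hne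
      · exact hx₂

theorem valuation_gen_pow (n : ℕ) : v₂ (g ^ n) = exp (-(n * d : ℤ)) := by
  rw [map_pow, h.gen₂, ← exp_nsmul]
  congr 1
  simp

theorem valuation_gen_mul_var_pow (i : ℕ) :
    v₂ (g * algebraMap F[X] K X ^ i) = exp (i - d : ℤ) := by
  rw [map_mul, map_pow, h.gen₂, h.var₂, ← exp_nsmul, ← exp_add]
  congr 1
  simp
  ring

theorem gen_mul_var_pow_mem {i : ℕ} (hi : i ≤ d) :
    g * algebraMap F[X] K X ^ i ∈ regularOutside F v₁.valuationSubring := by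
  rw [h.mem_regularOutside_iff, h.valuation_gen_mul_var_pow, ← exp_zero, exp_le_exp]
  exact ⟨h.isIntegral_gen.mul ((isIntegral_algebraMap (x := X)).pow i), by omega⟩

theorem gen_mem : g ∈ regularOutside F v₁.valuationSubring := by
  simpa using h.gen_mul_var_pow_mem (Nat.zero_le d)

theorem const_mem (c : F) :
    algebraMap F[X] K (C c) ∈ regularOutside F v₁.valuationSubring :=
  h.mem_regularOutside_iff.mpr ⟨isIntegral_algebraMap, h.const_le₂ c⟩

/-- Multiplying by a high power of `g` makes a function integral over `F[X]` regular outside of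
`v₁`. -/
theorem exists_gen_pow_mul_mem {x : K} (hx : IsIntegral F[X] x) :
    ∃ n : ℕ, g ^ n * x ∈ regularOutside F v₁.valuationSubring := by
  -- Each factor `g` lowers the pole order at `v₂` by `d ≥ 1`, so the pole order of `x`, truncated
  -- at 0, is a sufficient exponent.
  refine ⟨(log (v₂ x)).toNat, h.mem_regularOutside_iff.mpr
    ⟨(h.isIntegral_gen.pow _).mul hx, ?_⟩⟩
  by_cases hx0 : x = 0
  · simp [hx0]
  have hv : v₂ x ≠ 0 := (Valuation.ne_zero_iff _).mpr hx0
  rw [map_mul, h.valuation_gen_pow, ← exp_log hv, ← exp_add, ← exp_zero, exp_le_exp, log_exp]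
  have h1 := h.pos
  have h2 := Int.self_le_toNat (log (v₂ x))
  nlinarith

theorem isFractionRing : IsFractionRing (regularOutside F v₁.valuationSubring) K := by
  refine IsFractionRing.of_field _ _ fun x => ?_
  obtain ⟨y, hy, hy0, hyx⟩ := h.exists_isIntegral_mul x
  obtain ⟨m, hm⟩ := h.exists_gen_pow_mul_mem hy
  obtain ⟨n, hn⟩ := h.exists_gen_pow_mul_mem hyx
  have hg := h.gen_ne_zero
  refine ⟨⟨g ^ m * (g ^ n * (y * x)), mul_mem (pow_mem h.gen_mem m) hn⟩,
    ⟨g ^ n * (g ^ m * y), mul_mem (pow_mem h.gen_mem n) hm⟩, ?_⟩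
  change x = (g ^ m * (g ^ n * (y * x))) / (g ^ n * (g ^ m * y))
  field_simp

theorem isIntegrallyClosed : IsIntegrallyClosed (regularOutside F v₁.valuationSubring) := by
  have := h.isFractionRing
  refine (isIntegrallyClosed_iff K).mpr fun {x} hx => ?_
  suffices hmem : x ∈ regularOutside F v₁.valuationSubring from ⟨⟨x, hmem⟩, rfl⟩
  rw [regularOutside, Subring.mem_iInf]
  rintro ⟨V, hV, hne⟩
  exact mem_valuationSubring_of_isIntegralElem _ (fun r => regularOutside_le hV hne r.2) hx

/-- This makes the pole order at `v₁` a nonnegative degree function on nonzero elements. -/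
theorem one_le_valuation {x : K} (hx : x ∈ regularOutside F v₁.valuationSubring) (hx0 : x ≠ 0) :
    1 ≤ v₁ x := by
  obtain ⟨h1, h2⟩ := h.mem_regularOutside_iff.mp hx
  exact (h.one_le_mul x h1 hx0).trans (mul_le_of_le_one_right' h2)

/-- The residue field at `v₁` is `F`; apply this to the unit `x / y`. -/
theorem exists_sub_lt₁ {x y : K} (hy : y ≠ 0) (hxy : v₁ x = v₁ y) :
    ∃ c : F, v₁ (x - algebraMap F[X] K (C c) * y) < v₁ x := by
  have hv : v₁ y ≠ 0 := (Valuation.ne_zero_iff _).mpr hy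
  obtain ⟨c, hc⟩ := h.residue₁ (x / y) (by rw [map_div₀, hxy, div_self hv])
  refine ⟨c, ?_⟩
  rw [hxy]
  calc v₁ (x - algebraMap F[X] K (C c) * y) = v₁ (x / y - algebraMap F[X] K (C c)) * v₁ y := by
        rw [← map_mul, sub_mul, div_mul_cancel₀ _ hy]
    _ < v₁ y := by simpa using mul_lt_mul_of_pos_right hc (zero_lt_iff.mpr hv)

theorem exists_sub_lt₂ {x y : K} (hy : y ≠ 0) (hxy : v₂ x = v₂ y) :
    ∃ c : F, v₂ (x - algebraMap F[X] K (C c) * y) < v₂ x := by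
  have hv : v₂ y ≠ 0 := (Valuation.ne_zero_iff _).mpr hy
  obtain ⟨c, hc⟩ := h.residue₂ (x / y) (by rw [map_div₀, hxy, div_self hv])
  refine ⟨c, ?_⟩
  rw [hxy]
  calc v₂ (x - algebraMap F[X] K (C c) * y) = v₂ (x / y - algebraMap F[X] K (C c)) * v₂ y := by
        rw [← map_mul, sub_mul, div_mul_cancel₀ _ hy]
    _ < v₂ y := by simpa using mul_lt_mul_of_pos_right hc (zero_lt_iff.mpr hv)

theorem isDedekindDomain : IsDedekindDomain (regularOutside F v₁.valuationSubring) := by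
  have := h.isIntegrallyClosed
  let φ : F →+* regularOutside F v₁.valuationSubring :=
    ((algebraMap F[X] K).comp C).codRestrict _ h.const_mem
  let := φ.toAlgebra
  have hne (x : regularOutside F v₁.valuationSubring) (hx : x ≠ 0) : v₁ (x : K) ≠ 0 :=
    (Valuation.ne_zero_iff _).mpr (by simpa using hx)
  have hnn (x : regularOutside F v₁.valuationSubring) (hx : x ≠ 0) : 0 ≤ log (v₁ (x : K)) := by
    rw [← exp_le_exp, exp_zero, exp_log (hne x hx)]
    exact h.one_le_valuation x.2 (by simpa using hx)
  -- The degree is the pole order at `v₁`; `toNat` loses nothing, the logarithm being nonnegative on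
  -- nonzero elements.
  refine isDedekindDomain_of_finite_quotient (F := F) fun x hx =>
    finite_quotient_span_singleton_of_degree 
      (deg := fun x : regularOutside F v₁.valuationSubring => (log (v₁ (x : K))).toNat) ?_ ?_ hx
  · intro x y hx hy
    rw [Subring.coe_mul, map_mul, log_mul (hne x hx) (hne y hy),
      Int.toNat_add (hnn x hx) (hnn y hy)]
  · intro x y hx hy hxy
    have hlog : log (v₁ (x : K)) = log (v₁ (y : K)) := by
      have := hnn x hx
      have := hnn y hy
      omega
    obtain ⟨c, hc⟩ := h.exists_sub_lt₁ (x := (x : K)) (y := y) (by simpa using hy)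
      (by rw [← exp_log (hne x hx), hlog, exp_log (hne y hy)])
    refine ⟨c, or_iff_not_imp_left.mpr fun hz => ?_⟩
    have hcoe : ((x - c • y : regularOutside F v₁.valuationSubring) : K) =
        x - algebraMap F[X] K (C c) * y := rfl
    have hlt : log (v₁ ((x - c • y : regularOutside F v₁.valuationSubring) : K)) <
        log (v₁ (x : K)) := by
      rw [← exp_lt_exp, exp_log (hne _ hz), exp_log (hne x hx), hcoe]
      exact hc
    have := hnn _ hz
    omega

theorem mem_vanishingIdeal_iff (x : regularOutside F v₁.valuationSubring) :
    x ∈ vanishingIdeal h.isPlace₂ h.valuationSubring_ne ↔ v₂ (x : K) < 1 := by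
  rw [mem_vanishingIdeal]
  exact v₂.isEquiv_valuation_valuationSubring.symm.lt_one_iff_lt_one

/-- An element outside the ideal is a unit at `v₂`, hence congruent to a nonzero constant modulo the
ideal. -/
theorem isMaximal_vanishingIdeal :
    (vanishingIdeal h.isPlace₂ h.valuationSubring_ne).IsMaximal := by
  rw [Ideal.isMaximal_iff]
  refine ⟨by simp [h.mem_vanishingIdeal_iff], fun J x hJ hx hxJ => ?_⟩
  rw [h.mem_vanishingIdeal_iff] at hx
  have hx1 : v₂ (x : K) = 1 :=
    le_antisymm (h.mem_regularOutside_iff.mp x.2).2 (not_lt.mp hx)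
  obtain ⟨c, hc⟩ := h.residue₂ _ hx1
  have hc0 : c ≠ 0 := by
    rintro rfl
    simp [hx1] at hc
  have hcJ : (⟨_, h.const_mem c⟩ : regularOutside F v₁.valuationSubring) ∈ J := by
    rw [← sub_sub_cancel x ⟨_, h.const_mem c⟩]
    exact sub_mem hxJ (hJ ((h.mem_vanishingIdeal_iff _).mpr hc))
  have : (1 : regularOutside F v₁.valuationSubring) =
      ⟨_, h.const_mem c⁻¹⟩ * ⟨_, h.const_mem c⟩ := by
    ext
    change (1 : K) = algebraMap F[X] K (C c⁻¹) * algebraMap F[X] K (C c)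
    rw [← map_mul, ← C_mul, inv_mul_cancel₀ hc0, C_1, map_one]
  rw [this]
  exact Ideal.mul_mem_left _ _ hcJ

/-- The polar part at `v₂` is peeled off one term `c T ^ n` at a time, `T` having a simple pole
there. -/
theorem exists_sum_of_valuation_lt (n : ℕ) {y : K} (hy : IsIntegral F[X] y)
    (hyn : v₂ y < exp (n : ℤ)) : ∃ p : F[X], p.degree < n ∧ v₂ (y - algebraMap F[X] K p) ≤ 1 := by
  induction n generalizing y with
  | zero => exact ⟨0, by simp, by simpa using hyn.le⟩
  | succ n ih =>
    by_cases hlt : v₂ y < exp (n : ℤ)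
    · obtain ⟨p, hp, hpy⟩ := ih hy hlt
      exact ⟨p, hp.trans (by exact_mod_cast Nat.lt_succ_self n), hpy⟩
    · have hy0 : v₂ y ≠ 0 := fun h0 => hlt (by simp [h0])
      have hyeq : v₂ y = v₂ (algebraMap F[X] K X ^ n) := by
        rw [map_pow, h.var₂, ← exp_nsmul, ← exp_log hy0]
        rw [← exp_log hy0, exp_lt_exp] at hlt hyn
        congr 1
        push_cast at hyn
        simp
        omega
      obtain ⟨c, hc⟩ := h.exists_sub_lt₂ (pow_ne_zero n fun h0 =>
        exp_ne_zero (h.var₂.symm.trans (by rw [h0, map_zero]))) hyeq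
      rw [hyeq, map_pow, h.var₂, ← exp_nsmul, nsmul_one] at hc
      obtain ⟨p, hp, hpy⟩ := ih (hy.sub (isIntegral_algebraMap.mul ((isIntegral_algebraMap (x := X)).pow n))) hc
      refine ⟨C c * X ^ n + p, ?_, ?_⟩
      · refine (degree_add_le _ _).trans_lt (max_lt ?_ ?_)
        · exact (degree_C_mul_X_pow_le n c).trans_lt (by exact_mod_cast Nat.lt_succ_self n)
        · exact hp.trans (by exact_mod_cast Nat.lt_succ_self n)
      · rwa [map_add, map_mul, map_pow, ← sub_sub]

/-- For `x` vanishing at `v₂`, the pole of `g⁻¹ x` there has order below `d`. Subtracting a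
polynomial `p` of degree below `d` leaves a regular function `r`, and `x = r g + p g`. -/
theorem span_eq_vanishingIdeal :
    Ideal.span {x : regularOutside F v₁.valuationSubring |
      ∃ i ≤ d - 1, (x : K) = g * algebraMap F[X] K X ^ i} =
      vanishingIdeal h.isPlace₂ h.valuationSubring_ne := by
  have hd := h.pos
  apply le_antisymm
  · rw [Ideal.span_le]
    rintro x ⟨i, hi, hx⟩
    rw [SetLike.mem_coe, h.mem_vanishingIdeal_iff, hx, h.valuation_gen_mul_var_pow, ← exp_zero,
      exp_lt_exp]
    omega
  · intro x hx
    rw [h.mem_vanishingIdeal_iff] at hx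
    have hxi := (h.mem_regularOutside_iff.mp x.2).1
    have hg := h.gen_ne_zero
    have hlt : v₂ (g⁻¹ * x) < exp (d : ℤ) := by
      rw [map_mul, map_inv₀, h.gen₂, ← exp_neg, neg_neg]
      simpa using mul_lt_mul_of_pos_left hx (exp_pos (a := (d : ℤ)))
    obtain ⟨p, hp, hpy⟩ := h.exists_sum_of_valuation_lt d (h.isIntegral_gen_inv.mul hxi) hlt
    have hmem : g⁻¹ * x - algebraMap F[X] K p ∈ regularOutside F v₁.valuationSubring :=
      h.mem_regularOutside_iff.mpr
        ⟨(h.isIntegral_gen_inv.mul hxi).sub isIntegral_algebraMap, hpy⟩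
    have hgen (i : ℕ) (hi : i < d) :
        (⟨_, h.gen_mul_var_pow_mem hi.le⟩ : regularOutside F v₁.valuationSubring) ∈
        Ideal.span {x : regularOutside F v₁.valuationSubring |
          ∃ i ≤ d - 1, (x : K) = g * algebraMap F[X] K X ^ i} :=
      Ideal.subset_span ⟨i, by omega, rfl⟩
    have hx' : x = ⟨_, hmem⟩ * ⟨_, h.gen_mul_var_pow_mem (Nat.zero_le d)⟩ +
        ∑ i : Fin d, ⟨_, h.const_mem (p.coeff i)⟩ * ⟨_, h.gen_mul_var_pow_mem i.2.le⟩ := by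
      ext
      have hpsum : algebraMap F[X] K p =
          ∑ i : Fin d, algebraMap F[X] K (C (p.coeff i)) * algebraMap F[X] K X ^ (i : ℕ) := by
        conv_lhs => rw [p.as_sum_range_C_mul_X_pow' (n := d) (by
          by_cases hp0 : p = 0
          · simpa [hp0] using hd
          · exact (natDegree_lt_iff_degree_lt hp0).mpr hp), ← Fin.sum_univ_eq_sum_range
            (fun i => C (p.coeff i) * X ^ i)]
        simp
      rw [Subring.coe_add, Subring.coe_mul, AddSubmonoidClass.coe_finsetSum]
      simp only [Subring.coe_mul, pow_zero, mul_one]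
      rw [sub_mul, hpsum, Finset.sum_mul]
      rw [mul_comm g⁻¹, inv_mul_cancel_right₀ hg, sub_add, sub_eq_self.mpr]
      rw [sub_eq_zero]
      exact Finset.sum_congr rfl fun i _ => by ring
    rw [hx']
    exact add_mem (Ideal.mul_mem_left _ _ (hgen 0 hd))
      (sum_mem fun i _ => Ideal.mul_mem_left _ _ (hgen i i.2))

/-- The power `(g T ^ i) ^ d` is `g` times `g ^ (d - 1) T ^ (i d)`, which is regular at `v₂` because
`i ≤ d - 1`. So `Q` contains all generators of a maximal ideal. -/
theorem eq_vanishingIdeal_of_isPrime {Q : Ideal (regularOutside F v₁.valuationSubring)}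
    (hQ : Q.IsPrime) (hgQ : (⟨g, h.gen_mem⟩ : regularOutside F v₁.valuationSubring) ∈ Q) :
    Q = vanishingIdeal h.isPlace₂ h.valuationSubring_ne := by
  refine (h.isMaximal_vanishingIdeal.eq_of_le hQ.ne_top ?_).symm
  rw [← h.span_eq_vanishingIdeal, Ideal.span_le]
  rintro x ⟨i, hi, hx⟩
  have hd := h.pos
  refine hQ.mem_of_pow_mem d ?_
  have hmem : g ^ (d - 1) * (algebraMap F[X] K X ^ i) ^ d ∈
      regularOutside F v₁.valuationSubring := by
    rw [h.mem_regularOutside_iff, map_mul, h.valuation_gen_pow, map_pow, map_pow, h.var₂,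
      ← exp_nsmul, ← exp_nsmul, ← exp_add, ← exp_zero, exp_le_exp]
    refine ⟨(h.isIntegral_gen.pow _).mul (((isIntegral_algebraMap (x := X)).pow i).pow d), ?_⟩
    have : (i : ℤ) ≤ ((d - 1 : ℕ) : ℤ) := by exact_mod_cast hi
    simp only [nsmul_eq_mul, mul_one]
    nlinarith
  have hxd : x ^ d = ⟨_, hmem⟩ * ⟨g, h.gen_mem⟩ := by
    ext
    rw [Subring.coe_pow, Subring.coe_mul, hx, mul_pow]
    change g ^ d * _ = g ^ (d - 1) * _ * g
    rw [mul_right_comm, ← pow_succ, Nat.sub_add_cancel hd]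
  rw [hxd]
  exact Ideal.mul_mem_left _ _ hgQ

theorem gen_mem_vanishingIdeal : (⟨g, h.gen_mem⟩ : regularOutside F v₁.valuationSubring) ∈
    vanishingIdeal h.isPlace₂ h.valuationSubring_ne := by
  rw [h.mem_vanishingIdeal_iff, h.gen₂, ← exp_zero, exp_lt_exp]
  have := h.pos
  omega

theorem vanishingIdeal_ne_bot : vanishingIdeal h.isPlace₂ h.valuationSubring_ne ≠ ⊥ := by
  intro h0
  have := h.gen_mem_vanishingIdeal
  rw [h0, Ideal.mem_bot, Subtype.ext_iff] at this
  exact h.gen_ne_zero this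

theorem valuation_le_of_mem_pow {n : ℕ} {x : regularOutside F v₁.valuationSubring}
    (hx : x ∈ vanishingIdeal h.isPlace₂ h.valuationSubring_ne ^ n) :
    v₂ (x : K) ≤ exp (-n : ℤ) := by
  induction n generalizing x with
  | zero => simpa using (h.mem_regularOutside_iff.mp x.2).2
  | succ n ih =>
    rw [pow_succ] at hx
    refine Submodule.mul_induction_on hx (fun y hy z hz => ?_) fun y z hy hz => ?_
    · have hz1 : v₂ (z : K) ≤ exp (-1 : ℤ) := by
        rw [h.mem_vanishingIdeal_iff] at hz
        by_cases hz0 : v₂ (z : K) = 0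
        · simp [hz0]
        · rw [← exp_log hz0, ← exp_zero, exp_lt_exp] at hz
          rw [← exp_log hz0, exp_le_exp]
          omega
      rw [Subring.coe_mul, map_mul]
      refine (mul_le_mul' (ih hy) hz1).trans ?_
      rw [← exp_add, exp_le_exp]
      push_cast
      omega
    · exact (v₂.map_add _ _).trans (max_le hy hz)

/-- The upper bound holds on the whole power. For the lower one, `g T ^ (d - 1)` is a uniformizer at
`v₂` lying in the ideal, and its `n`-th power is a multiple of `x`. -/
theorem valuation_eq_of_pow_eq_span {n : ℕ} {x : regularOutside F v₁.valuationSubring}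
    (hx : vanishingIdeal h.isPlace₂ h.valuationSubring_ne ^ n = Ideal.span {x}) :
    v₂ (x : K) = exp (-n : ℤ) := by
  apply le_antisymm (h.valuation_le_of_mem_pow (hx ▸ Ideal.mem_span_singleton_self x))
  have hd := h.pos
  have hu : (⟨_, h.gen_mul_var_pow_mem (Nat.sub_le d 1)⟩ : regularOutside F v₁.valuationSubring) ∈
      vanishingIdeal h.isPlace₂ h.valuationSubring_ne := by
    rw [h.mem_vanishingIdeal_iff, h.valuation_gen_mul_var_pow, ← exp_zero, exp_lt_exp]
    omega
  have hun := Ideal.pow_mem_pow hu n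
  rw [hx, Ideal.mem_span_singleton] at hun
  obtain ⟨y, hy⟩ := hun
  have hv : exp (-n : ℤ) = v₂ (x : K) * v₂ (y : K) := by
    rw [← map_mul, ← Subring.coe_mul, ← hy, Subring.coe_pow, map_pow]
    change _ = v₂ (g * algebraMap F[X] K X ^ (d - 1)) ^ n
    rw [h.valuation_gen_mul_var_pow, ← exp_nsmul]
    congr 1
    rw [nsmul_eq_mul]
    push_cast [Nat.cast_sub hd]
    ring
  rw [hv]
  exact mul_le_of_le_one_right' (h.mem_regularOutside_iff.mp y.2).2

theorem orderOf_mk0_vanishingIdeal [IsDedekindDomain (regularOutside F v₁.valuationSubring)]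
    {I : Ideal (regularOutside F v₁.valuationSubring)}
    (hI : I = vanishingIdeal h.isPlace₂ h.valuationSubring_ne)
    (hP : I ∈ (Ideal (regularOutside F v₁.valuationSubring))⁰)
    (hfund : ∀ u : K, u ≠ 0 → IsIntegral F[X] u → IsIntegral F[X] u⁻¹ →
      ∃ (c : F) (n : ℤ), c ≠ 0 ∧ u = algebraMap F[X] K (C c) * g ^ n) :
    orderOf (ClassGroup.mk0 ⟨I, hP⟩) = d := by
  subst hI
  have hg0 := h.gen_ne_zero
  have hgA : (⟨g, h.gen_mem⟩ : regularOutside F v₁.valuationSubring) ≠ 0 := fun h0 =>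
    hg0 (congrArg Subtype.val h0)
  apply Nat.dvd_antisymm
  · rw [orderOf_dvd_iff_pow_eq_one, ← map_pow, ClassGroup.mk0_eq_one_iff]
    -- The ideal `(g)` is a power of the only prime containing `g`; the order of `g` at `v₂` shows
    -- that the exponent is `d`.
    obtain ⟨k, hk⟩ := ClassGroup.exists_eq_pow_of_pow_mem (s := ⟨g, h.gen_mem⟩) (n := 1)
      (P := vanishingIdeal h.isPlace₂ h.valuationSubring_ne)
      (fun Q hQ hgQ => h.eq_vanishingIdeal_of_isPrime hQ hgQ) hgA
      (by rw [pow_one]; exact Ideal.mem_span_singleton_self _)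
    have hv := h.valuation_eq_of_pow_eq_span hk.symm
    rw [h.gen₂, exp_inj, neg_inj, Nat.cast_inj] at hv
    subst hv
    exact ⟨⟨_, hk.symm⟩⟩
  · generalize hn : orderOf (ClassGroup.mk0 ⟨_, hP⟩) = n
    have h1 := pow_orderOf_eq_one (ClassGroup.mk0 ⟨_, hP⟩)
    rw [hn, ← map_pow, ClassGroup.mk0_eq_one_iff] at h1
    obtain ⟨x, hx⟩ := h1
    replace hx : vanishingIdeal h.isPlace₂ h.valuationSubring_ne ^ n = Ideal.span {x} := hx
    have hgx := Ideal.pow_mem_pow h.gen_mem_vanishingIdeal n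
    rw [hx, Ideal.mem_span_singleton] at hgx
    obtain ⟨y, hy⟩ := hgx
    replace hy : g ^ n = x * y := congrArg Subtype.val hy
    have hx0 : (x : K) ≠ 0 := fun h0 => pow_ne_zero n hg0 (by rw [hy, h0, zero_mul])
    -- As `x` divides `g ^ n`, it is a unit of the integral closure.
    obtain ⟨c, j, hc, hxc⟩ := hfund x hx0 (h.mem_regularOutside_iff.mp x.2).1 (by
      have : (x : K)⁻¹ = g⁻¹ ^ n * y := by
        rw [inv_pow, hy]
        have hy0 : (y : K) ≠ 0 := fun h0 => pow_ne_zero n hg0 (by rw [hy, h0, mul_zero])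
        field_simp
      rw [this]
      exact (h.isIntegral_gen_inv.pow n).mul (h.mem_regularOutside_iff.mp y.2).1)
    have hv := h.valuation_eq_of_pow_eq_span hx
    rw [hxc, map_mul, h.const₂ c hc, one_mul, map_zpow₀, h.gen₂, ← exp_zsmul, exp_inj,
      smul_eq_mul] at hv
    have : (d : ℤ) ∣ n := ⟨j, by linarith⟩
    exact_mod_cast this

/-- If the integral closure of `F[X]` is `F[X][g]`, then `g` is a fundamental unit. -/
theorem eq_const_mul_zpow (hrep : ∀ u : K, IsIntegral F[X] u →
      ∃ x y : F[X], u = algebraMap F[X] K x + algebraMap F[X] K y * g)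
    {u : K} (hu0 : u ≠ 0) (hu : IsIntegral F[X] u) (hu' : IsIntegral F[X] u⁻¹) :
    ∃ (c : F) (n : ℤ), c ≠ 0 ∧ u = algebraMap F[X] K (C c) * g ^ n := by
  have hd := h.pos
  have hg0 := h.gen_ne_zero
  have hzpow (n : ℤ) : IsIntegral F[X] (g ^ n) := by
    rcases n with n | n
    · rw [Int.ofNat_eq_natCast, zpow_natCast]
      exact h.isIntegral_gen.pow n
    · rw [zpow_negSucc, ← inv_pow]
      exact h.isIntegral_gen_inv.pow _
  have hv₁0 : v₁ u ≠ 0 := (Valuation.ne_zero_iff _).mpr hu0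
  have hv₂0 : v₂ u ≠ 0 := (Valuation.ne_zero_iff _).mpr hu0
  obtain ⟨m₁, hm₁⟩ : ∃ m : ℤ, v₁ u = exp m := ⟨_, (exp_log hv₁0).symm⟩
  obtain ⟨m₂, hm₂⟩ : ∃ m : ℤ, v₂ u = exp m := ⟨_, (exp_log hv₂0).symm⟩
  -- `one_le_mul` applies both to `u` and to its inverse.
  have hm : m₂ = -m₁ := by
    have h1 := h.one_le_mul u hu hu0
    have h2 := h.one_le_mul u⁻¹ hu' (inv_ne_zero hu0)
    rw [map_inv₀, map_inv₀, hm₁, hm₂, ← exp_neg, ← exp_neg, ← exp_add, ← exp_zero,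
      exp_le_exp] at h2
    rw [hm₁, hm₂, ← exp_add, ← exp_zero, exp_le_exp] at h1
    omega
  subst hm
  have hr0 : 0 ≤ m₁ % d := Int.emod_nonneg _ (by omega)
  have hrd : m₁ % d < d := Int.emod_lt_of_pos _ (by omega)
  have hdiv := Int.emod_add_mul_ediv m₁ d
  -- Dividing by a power of `g` brings the pole order at `v₁` into `[0, d)`.
  obtain ⟨w, hw⟩ : ∃ w, w = u * g ^ (-(m₁ / d)) := ⟨_, rfl⟩
  have hw₁ : v₁ w = exp (m₁ % d) := by
    rw [hw, map_mul, map_zpow₀, h.gen₁, hm₁, ← exp_zsmul, ← exp_add, smul_eq_mul]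
    congr 1
    linarith
  have hw₂ : v₂ w = exp (-(m₁ % d)) := by
    rw [hw, map_mul, map_zpow₀, h.gen₂, hm₂, ← exp_zsmul, ← exp_add, smul_eq_mul]
    congr 1
    linarith
  obtain ⟨x, y, hxy⟩ := hrep w (hw ▸ hu.mul (hzpow _))
  -- If `y ≠ 0`, then `y g` has a pole of order at least `d` at `v₁`, which `x` must cancel, so `deg
  -- x = deg y + d`. At `v₂` the term `y g` is smaller than `x`, so `w` would have a pole there,
  -- whereas `v₂ w ≤ 1`.
  have hy : y = 0 := by
    by_contra hy
    have hyg₁ : v₁ (algebraMap F[X] K y * g) = exp (y.natDegree + d : ℤ) := by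
      rw [map_mul, h.poly₁ y hy, h.gen₁, ← exp_add]
    have hyg₂ : v₂ (algebraMap F[X] K y * g) = exp (y.natDegree - d : ℤ) := by
      rw [map_mul, h.poly₂ y hy, h.gen₂, ← exp_add, sub_eq_add_neg]
    have hx₁ : v₁ (algebraMap F[X] K x) = exp (y.natDegree + d : ℤ) := by
      rw [← hyg₁, eq_sub_of_add_eq hxy.symm]
      refine v₁.map_sub_eq_of_lt_right ?_
      rw [hyg₁, hw₁, exp_lt_exp]
      omega
    have hx0 : x ≠ 0 := by
      rintro rfl
      exact exp_ne_zero (hx₁.symm.trans (by rw [map_zero, map_zero]))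
    have hx₂ : v₂ (algebraMap F[X] K x) = exp (y.natDegree + d : ℤ) := by
      rw [h.poly₂ x hx0, ← h.poly₁ x hx0, hx₁]
    have hw₂' : v₂ w = exp (y.natDegree + d : ℤ) := by
      rw [hxy, ← hx₂]
      refine v₂.map_add_eq_of_lt_left ?_
      rw [hyg₂, hx₂, exp_lt_exp]
      omega
    rw [hw₂, exp_inj] at hw₂'
    omega
  rw [hy, map_zero, zero_mul, add_zero] at hxy
  have hx0 : x ≠ 0 := by
    rintro rfl
    exact exp_ne_zero (hw₁.symm.trans (by rw [hxy, map_zero, map_zero]))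
  -- A nonzero polynomial has the same value at `v₁` and `v₂`, while those of `w` are inverse to
  -- each other.
  have hdeg : x.natDegree = 0 := by
    rw [hxy, h.poly₁ x hx0, exp_inj] at hw₁
    rw [hxy, h.poly₂ x hx0, exp_inj] at hw₂
    omega
  rw [eq_C_of_natDegree_eq_zero hdeg] at hxy hx0
  refine ⟨_, m₁ / d, C_ne_zero.mp hx0, ?_⟩
  rw [← hxy, hw, mul_assoc, ← zpow_add₀ hg0, neg_add_cancel, zpow_zero, mul_one]

end SplitUnit

end QuadUnit

/-! ### The quadratic field `K = k(f)` -/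

namespace QuadUnit

open WithZero
open scoped nonZeroDivisors

/-! ### The quadratic polynomial of `f`. -/

section Polynomial

variable {F : Type*} [Field F] {a : F[X]} {b : F}

theorem monic_quadratic (a : F[X]) (b : F) : (X ^ 2 - C (algebraMap F[X] (RatFunc F) a) * X -
    C (algebraMap F[X] (RatFunc F) (C b))).Monic := by
  monicity!

theorem natDegree_quadratic (a : F[X]) (b : F) :
    (X ^ 2 - C (algebraMap F[X] (RatFunc F) a) * X -
      C (algebraMap F[X] (RatFunc F) (C b))).natDegree = 2 := by
  compute_degree!

theorem aeval_quadratic {L : Type*} [Field L] [Algebra F[X] L] [Algebra (RatFunc F) L]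
    [IsScalarTower F[X] (RatFunc F) L] (x : L) :
    aeval x (X ^ 2 - C (algebraMap F[X] (RatFunc F) a) * X -
      C (algebraMap F[X] (RatFunc F) (C b))) =
      x ^ 2 - algebraMap F[X] L a * x - algebraMap F[X] L (C b) := by
  simp only [map_sub, map_mul, map_pow, aeval_X, aeval_C, ← IsScalarTower.algebraMap_apply]

theorem isIntegral_of_sq_eq {L : Type*} [Field L] [Algebra F[X] L] {x : L}
    (hx : x ^ 2 = algebraMap F[X] L a * x + algebraMap F[X] L (C b)) : IsIntegral F[X] x := by
  refine ⟨X ^ 2 - C a * X - C (C b), by monicity!, ?_⟩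
  simp [hx]

end Polynomial

/-! ### Residues in `k_∞` and the place at infinity of `k`. -/

section Completion

variable {F : Type*} [Field F] [DecidableEq (RatFunc F)]

theorem exists_ratFunc_valued_sub_lt_one (x : CompletionAtInfty F) :
    ∃ r : RatFunc F, Valued.v (x - algebraMap (RatFunc F) (CompletionAtInfty F) r) < 1 := by
  have hd : DenseRange (algebraMap (RatFunc F) (CompletionAtInfty F)) := by
    let := inftyValued F
    exact UniformSpace.Completion.denseRange_coe
  have ho : {y | Valued.v (y - x) < 1} ∈ nhds x := by
    rw [Valued.mem_nhds]
    exact ⟨1, fun y hy => by simpa using hy⟩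
  obtain ⟨r, hr⟩ := hd.mem_nhds ho
  exact ⟨r, by rw [Valuation.map_sub_swap]; exact hr⟩

theorem inftyValuation_algebraMap {p : F[X]} (hp : p ≠ 0) :
    inftyValuation F (algebraMap F[X] (RatFunc F) p) = exp (p.natDegree : ℤ) :=
  inftyValuation.polynomial F hp

theorem valued_algebraMap {p : F[X]} (hp : p ≠ 0) :
    Valued.v (algebraMap F[X] (CompletionAtInfty F) p) = exp (p.natDegree : ℤ) := by
  rw [IsScalarTower.algebraMap_apply F[X] (RatFunc F), valued_coe, inftyValuation_algebraMap hp]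

theorem exists_const_inftyValuation_sub_lt_one {r : RatFunc F} (hr : inftyValuation F r = 1) :
    ∃ c : F, inftyValuation F (r - algebraMap F[X] (RatFunc F) (C c)) < 1 := by
  induction r using RatFunc.induction_on with
  | f p q hq =>
    have hq' : algebraMap F[X] (RatFunc F) q ≠ 0 := by simpa using hq
    have hp : p ≠ 0 := by
      rintro rfl
      simp at hr
    have hqv : inftyValuation F (algebraMap F[X] (RatFunc F) q) ≠ 0 :=
      (Valuation.ne_zero_iff _).mpr hq'
    rw [map_div₀, div_eq_one_iff_eq hqv, inftyValuation_algebraMap hp,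
      inftyValuation_algebraMap hq, exp_inj, Nat.cast_inj] at hr
    refine ⟨p.leadingCoeff / q.leadingCoeff, ?_⟩
    have hlq : q.leadingCoeff ≠ 0 := leadingCoeff_ne_zero.mpr hq
    have hlp : p.leadingCoeff ≠ 0 := leadingCoeff_ne_zero.mpr hp
    have hlt : (p - C (p.leadingCoeff / q.leadingCoeff) * q).degree < p.degree := by
      refine degree_sub_lt_left ?_ hp ?_
      · rw [degree_C_mul (div_ne_zero hlp hlq), degree_eq_natDegree hp, degree_eq_natDegree hq, hr]
      · rw [leadingCoeff_mul, leadingCoeff_C, div_mul_cancel₀ _ hlq]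
    have heq : algebraMap F[X] (RatFunc F) p / algebraMap F[X] (RatFunc F) q -
        algebraMap F[X] (RatFunc F) (C (p.leadingCoeff / q.leadingCoeff)) =
        algebraMap F[X] (RatFunc F) (p - C (p.leadingCoeff / q.leadingCoeff) * q) /
          algebraMap F[X] (RatFunc F) q := by
      rw [map_sub, map_mul, sub_div, mul_div_cancel_right₀ _ hq']
    rw [heq, map_div₀, div_lt_one₀ (zero_lt_iff.mpr hqv)]
    by_cases h0 : p - C (p.leadingCoeff / q.leadingCoeff) * q = 0
    · rw [h0, map_zero, map_zero]
      exact zero_lt_iff.mpr hqv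
    · rw [inftyValuation_algebraMap h0, inftyValuation_algebraMap hq, exp_lt_exp, Nat.cast_lt, ← hr]
      exact natDegree_lt_natDegree h0 hlt

/-- By density of `k`, `x` may be replaced by a rational function, whose residue is a ratio of
leading coefficients. -/
theorem exists_const_valued_sub_lt_one {x : CompletionAtInfty F} (hx : Valued.v x = 1) :
    ∃ c : F, Valued.v (x - algebraMap F[X] (CompletionAtInfty F) (C c)) < 1 := by
  obtain ⟨r, hr⟩ := exists_ratFunc_valued_sub_lt_one x
  have hr1 : Valued.v (algebraMap (RatFunc F) (CompletionAtInfty F) r) = 1 := by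
    rw [← sub_sub_cancel x (algebraMap (RatFunc F) (CompletionAtInfty F) r), ← hx]
    exact Valuation.map_sub_eq_of_lt_left _ (hx ▸ hr)
  rw [valued_coe] at hr1
  obtain ⟨c, hc⟩ := exists_const_inftyValuation_sub_lt_one hr1
  refine ⟨c, ?_⟩
  rw [← valued_coe, map_sub, ← IsScalarTower.algebraMap_apply] at hc
  rw [← sub_add_sub_cancel x (algebraMap (RatFunc F) (CompletionAtInfty F) r)]
  exact Valuation.map_add_lt _ hr hc

/-- A place of `k = F(T)` at which `T` has a pole is the place at infinity. -/
theorem eq_infty_of_isPlace {V : ValuationSubring (RatFunc F)} (hV : ∀ c : F, RatFunc.C c ∈ V)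
    (hT : RatFunc.X ∉ V) : V = (inftyValuation F).valuationSubring := by
  have htriv : V.valuation.IsTrivialOn F := ⟨fun c hc => by
    refine le_antisymm ((V.valuation_le_one_iff _).mpr (hV c)) ?_
    have h1 := (V.valuation_le_one_iff _).mpr (hV c⁻¹)
    rw [map_inv₀, map_inv₀] at h1
    exact (inv_le_one₀ (zero_lt_iff.mpr ((Valuation.ne_zero_iff _).mpr (by simpa using hc)))).mp h1⟩
  rw [← V.valuationSubring_valuation]
  refine (Valuation.isEquiv_iff_valuationSubring _ _).mp
    (RatFunc.valuation_isEquiv_inftyValuation_of_one_lt_valuation_X ?_)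
  rwa [← not_le, V.valuation_le_one_iff]

end Completion

/-! ### The quadratic extension `K/k` and its conjugation. -/

section Quadratic

variable {F : Type*} [Field F] [DecidableEq (RatFunc F)] {a : F[X]} {b : F}
  {f : CompletionAtInfty F}

theorem valued_eq_of_conj_lt
    (hconj : Valued.v (algebraMap F[X] (CompletionAtInfty F) a - f) < Valued.v f) (ha : a ≠ 0) :
    Valued.v f = exp (a.natDegree : ℤ) := by
  rw [← valued_algebraMap ha, ← Valuation.map_add_eq_of_lt_left _ hconj, add_sub_cancel]

theorem mul_conj_eq (hf : f ^ 2 = algebraMap F[X] (CompletionAtInfty F) a * f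
      + algebraMap F[X] (CompletionAtInfty F) (C b)) :
    f * (algebraMap F[X] (CompletionAtInfty F) a - f) =
      -algebraMap F[X] (CompletionAtInfty F) (C b) := by
  linear_combination -hf

theorem valued_conj_eq (hb : b ≠ 0) (hf : f ^ 2 = algebraMap F[X] (CompletionAtInfty F) a * f
      + algebraMap F[X] (CompletionAtInfty F) (C b)) {d : ℕ} (hfd : Valued.v f = exp (d : ℤ)) :
    Valued.v (algebraMap F[X] (CompletionAtInfty F) a - f) = exp (-d : ℤ) := by
  have h := congrArg Valued.v (mul_conj_eq hf)
  rw [map_mul, hfd, Valuation.map_neg, valued_algebraMap (C_ne_zero.mpr hb), natDegree_C,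
    Nat.cast_zero, exp_zero] at h
  rw [exp_neg]
  exact eq_inv_of_mul_eq_one_right h

/-- An `f` in `k` would be integral, hence a polynomial, and a divisor of the constant `-b`, hence a
constant, of absolute value 1. -/
theorem notMem_range_of_valued (hb : b ≠ 0)
    (hf : f ^ 2 = algebraMap F[X] (CompletionAtInfty F) a * f
      + algebraMap F[X] (CompletionAtInfty F) (C b)) (hf1 : Valued.v f ≠ 1) :
    f ∉ (algebraMap (RatFunc F) (CompletionAtInfty F)).range := by
  rintro ⟨r, rfl⟩
  have hint : IsIntegral F[X] r :=
    (isIntegral_algHom_iff (IsScalarTower.toAlgHom F[X] (RatFunc F) (CompletionAtInfty F))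
      (algebraMap (RatFunc F) (CompletionAtInfty F)).injective).mp (isIntegral_of_sq_eq hf)
  obtain ⟨p, rfl⟩ := IsIntegrallyClosed.isIntegral_iff.mp hint
  rw [← IsScalarTower.algebraMap_apply] at hf hf1
  have hmul := mul_conj_eq hf
  have hinj : Function.Injective (algebraMap F[X] (CompletionAtInfty F)) :=
    (algebraMap (RatFunc F) (CompletionAtInfty F)).injective.comp
      (IsFractionRing.injective F[X] (RatFunc F))
  rw [← map_sub, ← map_mul, ← map_neg] at hmul
  have hp : IsUnit p := isUnit_of_mul_isUnit_left (y := a - p) (by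
    rw [hinj hmul, IsUnit.neg_iff, isUnit_C]
    exact hb.isUnit)
  refine hf1 ?_
  rw [valued_algebraMap hp.ne_zero, natDegree_eq_zero_of_isUnit hp, Nat.cast_zero, exp_zero]

theorem minpoly_eq (hb : b ≠ 0) (hf : f ^ 2 = algebraMap F[X] (CompletionAtInfty F) a * f
      + algebraMap F[X] (CompletionAtInfty F) (C b)) (hf1 : Valued.v f ≠ 1) :
    IsIntegral (RatFunc F) f ∧ minpoly (RatFunc F) f =
      X ^ 2 - C (algebraMap F[X] (RatFunc F) a) * X - C (algebraMap F[X] (RatFunc F) (C b)) := by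
  have h0 : aeval f (X ^ 2 - C (algebraMap F[X] (RatFunc F) a) * X -
      C (algebraMap F[X] (RatFunc F) (C b))) = 0 := by
    rw [aeval_quadratic, hf]
    ring
  have hint : IsIntegral (RatFunc F) f := ⟨_, monic_quadratic a b, h0⟩
  refine ⟨hint, (eq_of_monic_of_dvd_of_natDegree_le (minpoly.monic hint) (monic_quadratic a b)
    (minpoly.dvd _ _ h0) ?_).symm⟩
  rw [natDegree_quadratic]
  exact (minpoly.two_le_natDegree_iff hint).mpr (notMem_range_of_valued hb hf hf1)

theorem gen_sq (hf : f ^ 2 = algebraMap F[X] (CompletionAtInfty F) a * f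
      + algebraMap F[X] (CompletionAtInfty F) (C b)) :
    gen f ^ 2 = algebraMap F[X] (fieldK f) a * gen f + algebraMap F[X] (fieldK f) (C b) :=
  Subtype.ext hf

/-- The nontrivial automorphism of `K = k(f)`. -/
theorem exists_conj (hb : b ≠ 0) (hf : f ^ 2 = algebraMap F[X] (CompletionAtInfty F) a * f
      + algebraMap F[X] (CompletionAtInfty F) (C b)) (hf1 : Valued.v f ≠ 1) :
    ∃ σ : fieldK f →ₐ[RatFunc F] fieldK f,
      σ (gen f) = algebraMap F[X] (fieldK f) a - gen f ∧ ∀ x, σ (σ x) = x := by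
  obtain ⟨hint, hmin⟩ := minpoly_eq hb hf hf1
  have hroot : algebraMap F[X] (fieldK f) a - gen f ∈
      (minpoly (RatFunc F) f).aroots (fieldK f) := by
    rw [mem_aroots, hmin, aeval_quadratic]
    refine ⟨(monic_quadratic a b).ne_zero, ?_⟩
    linear_combination gen_sq hf
  obtain ⟨σ, hσ⟩ : ∃ σ : fieldK f →ₐ[RatFunc F] fieldK f,
      σ (gen f) = algebraMap F[X] (fieldK f) a - gen f :=
    ⟨_, IntermediateField.algHomAdjoinIntegralEquiv_symm_apply_gen (RatFunc F) hint ⟨_, hroot⟩⟩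
  have hσσ : σ (σ (gen f)) = gen f := by
    rw [hσ, map_sub, hσ, IsScalarTower.algebraMap_apply F[X] (RatFunc F), AlgHom.commutes]
    ring
  have hid : σ.comp σ = AlgHom.id (RatFunc F) (fieldK f) := by
    refine IntermediateField.adjoin_algHom_ext (RatFunc F) fun y hy => ?_
    obtain rfl : f = y := (Set.mem_singleton_iff.mp hy).symm
    exact hσσ
  exact ⟨σ, hσ, fun x => DFunLike.congr_fun hid x⟩

/-- The valuation of `K` attached to `∞₁`. -/
noncomputable def valuation₁ (f : CompletionAtInfty F) : Valuation (fieldK f) ℤᵐ⁰ :=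
  (Valued.v : Valuation (CompletionAtInfty F) ℤᵐ⁰).comap
    (algebraMap (fieldK f) (CompletionAtInfty F))

theorem infty₁_eq (f : CompletionAtInfty F) : infty₁ f = (valuation₁ f).valuationSubring := rfl

theorem valuation₁_algebraMap (f : CompletionAtInfty F) (r : RatFunc F) :
    valuation₁ f (algebraMap (RatFunc F) (fieldK f) r) = inftyValuation F r :=
  valued_coe r

theorem exists_eq_add_mul_gen (hint : IsIntegral (RatFunc F) f)
    (hf : f ^ 2 = algebraMap F[X] (CompletionAtInfty F) a * f
      + algebraMap F[X] (CompletionAtInfty F) (C b)) (x : fieldK f) :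
    ∃ r s : RatFunc F, x = algebraMap (RatFunc F) (fieldK f) r +
      algebraMap (RatFunc F) (fieldK f) s * gen f := by
  have hx : (x : CompletionAtInfty F) ∈ Algebra.adjoin (RatFunc F) {f} := by
    rw [← IntermediateField.adjoin_simple_toSubalgebra_of_isAlgebraic hint.isAlgebraic]
    exact x.2
  suffices h : ∃ r s : RatFunc F, (x : CompletionAtInfty F) =
      algebraMap (RatFunc F) (CompletionAtInfty F) r +
      algebraMap (RatFunc F) (CompletionAtInfty F) s * f by
    obtain ⟨r, s, h⟩ := h
    exact ⟨r, s, Subtype.ext h⟩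
  generalize (x : CompletionAtInfty F) = y at hx ⊢
  induction hx using Algebra.adjoin_induction with
  | mem y hy => exact ⟨0, 1, by rw [Set.mem_singleton_iff.mp hy]; simp⟩
  | algebraMap r => exact ⟨r, 0, by simp⟩
  | add y z _ _ hy hz =>
    obtain ⟨r, s, rfl⟩ := hy
    obtain ⟨t, u, rfl⟩ := hz
    exact ⟨r + t, s + u, by rw [map_add, map_add]; ring⟩
  | mul y z _ _ hy hz =>
    obtain ⟨r, s, rfl⟩ := hy
    obtain ⟨t, u, rfl⟩ := hz
    rw [IsScalarTower.algebraMap_apply F[X] (RatFunc F),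
      IsScalarTower.algebraMap_apply F[X] (RatFunc F) _ (C b)] at hf
    refine ⟨r * t + s * u * algebraMap F[X] (RatFunc F) (C b),
      r * u + s * t + s * u * algebraMap F[X] (RatFunc F) a, ?_⟩
    simp only [map_add, map_mul]
    linear_combination algebraMap (RatFunc F) (CompletionAtInfty F) s *
      algebraMap (RatFunc F) (CompletionAtInfty F) u * hf

end Quadratic

/-! ### Valuation rings containing an intersection of two others. -/

section ValuationSubring

variable {K : Type*} [Field K]

/-- Multiplying `x` by a high power of `u` removes its pole at `w₂` without changing `w₁ x`; the
product lies in `V`, and so does `u⁻¹`. -/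
theorem valuationSubring_le_of_inf_le {w₁ w₂ : Valuation K ℤᵐ⁰} {V : ValuationSubring K}
    (hinf : ∀ x, w₁ x ≤ 1 → w₂ x ≤ 1 → x ∈ V) {u : K} (hu₁ : w₁ u = 1) (hu₂ : w₂ u < 1)
    (hu : u⁻¹ ∈ V) : w₁.valuationSubring ≤ V := by
  intro x hx
  rw [Valuation.mem_valuationSubring_iff] at hx
  have hu0 : u ≠ 0 := by
    rintro rfl
    simp at hu₁
  obtain ⟨n, hn⟩ : ∃ n : ℕ, w₂ (x * u ^ n) ≤ 1 := by
    by_cases hx0 : x = 0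
    · exact ⟨0, by simp [hx0]⟩
    have hx' := (Valuation.ne_zero_iff w₂).mpr hx0
    have hu' := (Valuation.ne_zero_iff w₂).mpr hu0
    refine ⟨(log (w₂ x)).toNat, ?_⟩
    rw [← exp_log hu', ← exp_zero, exp_lt_exp] at hu₂
    rw [map_mul, map_pow, ← exp_log hx', ← exp_log hu', ← exp_nsmul, ← exp_add, ← exp_zero,
      exp_le_exp, log_exp, nsmul_eq_mul]
    have := Int.self_le_toNat (log (w₂ x))
    nlinarith
  have hmem := hinf (x * u ^ n) (by rwa [map_mul, map_pow, hu₁, one_pow, mul_one]) hn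
  have := mul_mem hmem (pow_mem hu n)
  rwa [mul_assoc, ← mul_pow, mul_inv_cancel₀ hu0, one_pow, mul_one] at this

/-- A valuation ring with value group in `ℤ` is maximal among proper ones: given `y ∈ V` with `w y >
1`, any `z` is a power of `y` times an element of the ring of `w`. -/
theorem eq_valuationSubring_of_le {w : Valuation K ℤᵐ⁰} {V : ValuationSubring K}
    (hle : w.valuationSubring ≤ V) (hV : V ≠ ⊤) : V = w.valuationSubring := by
  refine le_antisymm (fun y hy => ?_) hle
  by_contra hyw
  rw [Valuation.mem_valuationSubring_iff, not_le] at hyw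
  refine hV (eq_top_iff.mpr fun z _ => ?_)
  have hy0 : y ≠ 0 := by
    rintro rfl
    simp at hyw
  by_cases hz0 : z = 0
  · rw [hz0]; exact zero_mem _
  have hz' := (Valuation.ne_zero_iff w).mpr hz0
  have hy' := (Valuation.ne_zero_iff w).mpr hy0
  have hmem : z * (y⁻¹) ^ (log (w z)).toNat ∈ w.valuationSubring := by
    rw [← exp_log hy', ← exp_zero, exp_lt_exp] at hyw
    rw [Valuation.mem_valuationSubring_iff, map_mul, map_pow, map_inv₀, ← exp_log hz',
      ← exp_log hy', ← exp_neg, ← exp_nsmul, ← exp_add, ← exp_zero, exp_le_exp, log_exp,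
      nsmul_eq_mul]
    have := Int.self_le_toNat (log (w z))
    nlinarith
  have := mul_mem (hle hmem) (pow_mem hy (log (w z)).toNat)
  rwa [mul_assoc, ← mul_pow, inv_mul_cancel₀ hy0, one_pow, mul_one] at this

end ValuationSubring

variable {F : Type*} [Field F] [DecidableEq (RatFunc F)] {a : F[X]} {b : F} {d : ℕ}
  {f : CompletionAtInfty F}

theorem liesOverInfty_iff {V : ValuationSubring (fieldK f)} : LiesOverInfty V ↔
    ∀ r : RatFunc F, algebraMap (RatFunc F) (fieldK f) r ∈ V ↔ inftyValuation F r ≤ 1 := by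
  rw [LiesOverInfty, SetLike.ext_iff]
  rfl

theorem liesOverInfty_of_isPlace {V : ValuationSubring (fieldK f)} (hV : IsPlace F V)
    (hT : varT f ∉ V) : LiesOverInfty V := by
  refine eq_infty_of_isPlace (fun c => ?_) fun h => hT ?_
  · have := hV.2 c
    rwa [IsScalarTower.algebraMap_apply F[X] (RatFunc F), RatFunc.algebraMap_C] at this
  · rw [varT, IsScalarTower.algebraMap_apply F[X] (RatFunc F), RatFunc.algebraMap_X]
    exact h

theorem varT_notMem_of_liesOverInfty {V : ValuationSubring (fieldK f)} (hV : LiesOverInfty V) :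
    varT f ∉ V := by
  rw [varT, IsScalarTower.algebraMap_apply F[X] (RatFunc F), RatFunc.algebraMap_X,
    liesOverInfty_iff.mp hV, inftyValuation.X]
  decide

/-! ### The two places of `K` above infinity. -/

section Conj

variable {σ : fieldK f →ₐ[RatFunc F] fieldK f}

theorem conj_algebraMap (σ : fieldK f →ₐ[RatFunc F] fieldK f) (p : F[X]) :
    σ (algebraMap F[X] (fieldK f) p) = algebraMap F[X] (fieldK f) p := by
  rw [IsScalarTower.algebraMap_apply F[X] (RatFunc F), AlgHom.commutes]

/-- The valuation of `K` conjugate to the one attached to `∞₁`. -/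
noncomputable def valuation₂ (σ : fieldK f →ₐ[RatFunc F] fieldK f) : Valuation (fieldK f) ℤᵐ⁰ :=
  (valuation₁ f).comap σ.toRingHom

theorem valuation₂_apply (σ : fieldK f →ₐ[RatFunc F] fieldK f) (x : fieldK f) :
    valuation₂ σ x = valuation₁ f (σ x) := rfl

theorem valuation₂_algebraMap (σ : fieldK f →ₐ[RatFunc F] fieldK f) (r : RatFunc F) :
    valuation₂ σ (algebraMap (RatFunc F) (fieldK f) r) = inftyValuation F r := by
  rw [valuation₂_apply, AlgHom.commutes, valuation₁_algebraMap]

theorem exists_trace_norm (hint : IsIntegral (RatFunc F) f)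
    (hf : f ^ 2 = algebraMap F[X] (CompletionAtInfty F) a * f
      + algebraMap F[X] (CompletionAtInfty F) (C b))
    (hσ : σ (gen f) = algebraMap F[X] (fieldK f) a - gen f) (x : fieldK f) :
    ∃ t n : RatFunc F, x + σ x = algebraMap (RatFunc F) (fieldK f) t ∧
      x * σ x = algebraMap (RatFunc F) (fieldK f) n := by
  obtain ⟨r, s, rfl⟩ := exists_eq_add_mul_gen hint hf x
  have hg := gen_sq hf
  rw [IsScalarTower.algebraMap_apply F[X] (RatFunc F),
    IsScalarTower.algebraMap_apply F[X] (RatFunc F) _ (C b)] at hg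
  rw [IsScalarTower.algebraMap_apply F[X] (RatFunc F)] at hσ
  refine ⟨2 * r + s * algebraMap F[X] (RatFunc F) a,
    r ^ 2 + r * s * algebraMap F[X] (RatFunc F) a - s ^ 2 * algebraMap F[X] (RatFunc F) (C b),
    ?_, ?_⟩
  · simp only [map_add, map_mul, AlgHom.commutes, hσ, map_ofNat]
    ring
  · simp only [map_add, map_sub, map_mul, map_pow, AlgHom.commutes, hσ]
    linear_combination -(algebraMap (RatFunc F) (fieldK f) s) ^ 2 * hg

/-- The trace `t` and norm `n` of `x` are regular at infinity, hence lie in `V`. If `x⁻¹ ∈ V`, then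
`x = t - n x⁻¹` does too. -/
theorem mem_of_liesOverInfty (hint : IsIntegral (RatFunc F) f)
    (hf : f ^ 2 = algebraMap F[X] (CompletionAtInfty F) a * f
      + algebraMap F[X] (CompletionAtInfty F) (C b))
    (hσ : σ (gen f) = algebraMap F[X] (fieldK f) a - gen f)
    {V : ValuationSubring (fieldK f)} (hV : LiesOverInfty V) {x : fieldK f}
    (h₁ : valuation₁ f x ≤ 1) (h₂ : valuation₂ σ x ≤ 1) : x ∈ V := by
  rw [liesOverInfty_iff] at hV
  obtain ⟨t, n, ht, hn⟩ := exists_trace_norm hint hf hσ x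
  have htV : algebraMap (RatFunc F) (fieldK f) t ∈ V := by
    rw [hV, ← valuation₁_algebraMap f, ← ht]
    exact Valuation.map_add_le _ h₁ h₂
  have hnV : algebraMap (RatFunc F) (fieldK f) n ∈ V := by
    rw [hV, ← valuation₁_algebraMap f, ← hn, map_mul]
    exact mul_le_one' h₁ h₂
  rcases V.mem_or_inv_mem x with hx | hx
  · exact hx
  by_cases hx0 : x = 0
  · rw [hx0]; exact zero_mem _
  have : x = algebraMap (RatFunc F) (fieldK f) t - algebraMap (RatFunc F) (fieldK f) n * x⁻¹ := by
    rw [← ht, ← hn]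
    field_simp
    ring
  rw [this]
  exact sub_mem htV (mul_mem hnV hx)

theorem gen_mul_conj (hf : f ^ 2 = algebraMap F[X] (CompletionAtInfty F) a * f
      + algebraMap F[X] (CompletionAtInfty F) (C b)) :
    gen f * (algebraMap F[X] (fieldK f) a - gen f) = -algebraMap F[X] (fieldK f) (C b) :=
  Subtype.ext (mul_conj_eq hf)

theorem valuation₁_poly (f : CompletionAtInfty F) {p : F[X]} (hp : p ≠ 0) :
    valuation₁ f (algebraMap F[X] (fieldK f) p) = exp (p.natDegree : ℤ) :=
  valued_algebraMap hp

theorem valuation₂_poly (σ : fieldK f →ₐ[RatFunc F] fieldK f) {p : F[X]} (hp : p ≠ 0) :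
    valuation₂ σ (algebraMap F[X] (fieldK f) p) = exp (p.natDegree : ℤ) := by
  rw [valuation₂_apply, conj_algebraMap, valuation₁_poly f hp]

/-- As `a ∉ V`, one of `f` and `f* = a - f` is outside `V`. If it is `f`, then `u = f / a` is a unit
at `∞₁`, vanishes at `∞₂`, and `u⁻¹ = 1 + f* / f = 1 - b f⁻² ∈ V`; so `V` contains the valuation
ring of `∞₁` and equals it. The other case is conjugate. -/
theorem eq_or_eq_of_liesOverInfty (ha : a.natDegree = d) (hd : 0 < d) (hb : b ≠ 0)
    (hint : IsIntegral (RatFunc F) f)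
    (hf : f ^ 2 = algebraMap F[X] (CompletionAtInfty F) a * f
      + algebraMap F[X] (CompletionAtInfty F) (C b)) (hfd : Valued.v f = exp (d : ℤ))
    (hσ : σ (gen f) = algebraMap F[X] (fieldK f) a - gen f) (hσσ : ∀ x, σ (σ x) = x)
    {V : ValuationSubring (fieldK f)} (hV : LiesOverInfty V) :
    V = (valuation₁ f).valuationSubring ∨ V = (valuation₂ σ).valuationSubring := by
  have hTV := varT_notMem_of_liesOverInfty hV
  have htop : V ≠ ⊤ := fun h => hTV (h ▸ ValuationSubring.mem_top _)
  have ha0 : a ≠ 0 := by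
    rintro rfl
    rw [natDegree_zero] at ha
    omega
  have hmul := gen_mul_conj hf
  obtain ⟨α, hα⟩ : ∃ α, α = algebraMap F[X] (fieldK f) a := ⟨_, rfl⟩
  have hα₁ : valuation₁ f α = exp (d : ℤ) := by rw [hα, valuation₁_poly f ha0, ha]
  have hα₂ : valuation₂ σ α = exp (d : ℤ) := by rw [hα, valuation₂_poly σ ha0, ha]
  have hα0 : α ≠ 0 := by
    rintro rfl
    exact exp_ne_zero (hα₁.symm.trans (map_zero _))
  have hαV : α ∉ V := by
    rw [hα, IsScalarTower.algebraMap_apply F[X] (RatFunc F), liesOverInfty_iff.mp hV,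
      inftyValuation_algebraMap ha0, ← exp_zero, exp_le_exp]
    omega
  have hbV : algebraMap F[X] (fieldK f) (C b) ∈ V := by
    rw [IsScalarTower.algebraMap_apply F[X] (RatFunc F), liesOverInfty_iff.mp hV,
      inftyValuation_algebraMap (C_ne_zero.mpr hb), natDegree_C, Nat.cast_zero, exp_zero]
  rw [← hα] at hmul hσ
  have hg₁ : valuation₁ f (gen f) = exp (d : ℤ) := hfd
  have hc₁ : valuation₁ f (α - gen f) = exp (-d : ℤ) := by
    rw [hα]
    exact valued_conj_eq hb hf hfd
  have hg₂ : valuation₂ σ (gen f) = exp (-d : ℤ) := by rw [valuation₂_apply, hσ, hc₁]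
  have hc₂ : valuation₂ σ (α - gen f) = exp (d : ℤ) := by
    rw [valuation₂_apply, ← hσ, hσσ, hg₁]
  have hinv {x y : fieldK f} (hx : x ∉ V) (hxy : x + y = α)
      (hm : x * y = -algebraMap F[X] (fieldK f) (C b)) : (x / α)⁻¹ ∈ V := by
    have hx0 : x ≠ 0 := by
      rintro rfl
      exact hx (zero_mem _)
    have hx' : x⁻¹ ∈ V := (V.mem_or_inv_mem x).resolve_left hx
    have : (x / α)⁻¹ = 1 + -algebraMap F[X] (fieldK f) (C b) * (x⁻¹ * x⁻¹) := by
      rw [← hm, ← hxy]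
      field_simp
    rw [this]
    exact add_mem (one_mem _) (mul_mem (neg_mem hbV) (mul_mem hx' hx'))
  have hlt : (exp (-d : ℤ) : ℤᵐ⁰) / exp (d : ℤ) < 1 := by
    rw [← exp_sub, ← exp_zero, exp_lt_exp]
    omega
  by_cases hgV : gen f ∈ V
  · have hcV : α - gen f ∉ V := fun h => hαV (by
      rw [← sub_add_cancel α (gen f)]
      exact add_mem h hgV)
    refine Or.inr (eq_valuationSubring_of_le (valuationSubring_le_of_inf_le
      (fun x h₂ h₁ => mem_of_liesOverInfty hint hf (hα ▸ hσ) hV h₁ h₂)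
      (u := (α - gen f) / α) ?_ ?_ (hinv (y := gen f) hcV (by ring) (by rw [mul_comm, hmul]))) htop)
    · rw [map_div₀, hc₂, hα₂, div_self exp_ne_zero]
    · rwa [map_div₀, hc₁, hα₁]
  · refine Or.inl (eq_valuationSubring_of_le (valuationSubring_le_of_inf_le
      (fun x h₁ h₂ => mem_of_liesOverInfty hint hf (hα ▸ hσ) hV h₁ h₂)
      (u := gen f / α) ?_ ?_ (hinv hgV (by ring) hmul)) htop)
    · rw [map_div₀, hg₁, hα₁, div_self exp_ne_zero]
    · rwa [map_div₀, hg₂, hα₂]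

theorem splitUnit (ha : a.natDegree = d) (hd : 0 < d) (hb : b ≠ 0)
    (hint : IsIntegral (RatFunc F) f)
    (hf : f ^ 2 = algebraMap F[X] (CompletionAtInfty F) a * f
      + algebraMap F[X] (CompletionAtInfty F) (C b)) (hfd : Valued.v f = exp (d : ℤ))
    (hσ : σ (gen f) = algebraMap F[X] (fieldK f) a - gen f) (hσσ : ∀ x, σ (σ x) = x) :
    SplitUnit F (valuation₁ f) (valuation₂ σ) (gen f) d where
  pos := hd
  poly₁ p hp := valuation₁_poly f hp
  poly₂ p hp := valuation₂_poly σ hp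
  gen₁ := hfd
  gen₂ := by
    rw [valuation₂_apply, hσ]
    exact valued_conj_eq hb hf hfd
  residue₁ z hz := exists_const_valued_sub_lt_one hz
  residue₂ z hz := by
    obtain ⟨c, hc⟩ := exists_const_valued_sub_lt_one (x := (σ z : CompletionAtInfty F)) hz
    refine ⟨c, ?_⟩
    rw [valuation₂_apply, map_sub, conj_algebraMap]
    exact hc
  isIntegral_gen := isIntegral_of_sq_eq (gen_sq hf)
  isIntegral_gen_inv := by
    have hb' : algebraMap F[X] (fieldK f) (C b⁻¹) * algebraMap F[X] (fieldK f) (C b) = 1 := by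
      rw [← map_mul, ← C_mul, inv_mul_cancel₀ hb, C_1, map_one]
    have : (gen f)⁻¹ = -algebraMap F[X] (fieldK f) (C b⁻¹) *
        (algebraMap F[X] (fieldK f) a - gen f) := by
      refine (eq_inv_of_mul_eq_one_right ?_).symm
      linear_combination -algebraMap F[X] (fieldK f) (C b⁻¹) * gen_mul_conj hf + hb'
    rw [this]
    exact isIntegral_algebraMap.neg.mul
      (isIntegral_algebraMap.sub (isIntegral_of_sq_eq (gen_sq hf)))
  one_le_mul x hx hx0 := by
    -- The product `v₁ x * v₂ x` is the value at infinity of the norm `x σ(x)`, a nonzero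
    -- polynomial.
    obtain ⟨t, n, -, hn⟩ := exists_trace_norm hint hf hσ x
    have hσx : IsIntegral F[X] (σ x) := hx.map (σ.restrictScalars F[X])
    have hnint : IsIntegral F[X] n :=
      (isIntegral_algHom_iff (IsScalarTower.toAlgHom F[X] (RatFunc F) (fieldK f))
        (algebraMap (RatFunc F) (fieldK f)).injective).mp (by
          change IsIntegral F[X] (algebraMap (RatFunc F) (fieldK f) n)
          exact hn ▸ hx.mul hσx)
    obtain ⟨p, rfl⟩ := IsIntegrallyClosed.isIntegral_iff.mp hnint
    have hp : p ≠ 0 := by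
      rintro rfl
      rw [map_zero, map_zero] at hn
      exact mul_ne_zero hx0 ((map_ne_zero σ).mpr hx0) hn
    rw [valuation₂_apply, ← map_mul, hn, ← IsScalarTower.algebraMap_apply, valuation₁_poly f hp,
      ← exp_zero, exp_le_exp]
    omega
  exists_isIntegral_mul x := by
    have := IntermediateField.isAlgebraic_adjoin_simple hint
    have hx : IsAlgebraic F[X] x :=
      (IsFractionRing.isAlgebraic_iff F[X] (RatFunc F) (fieldK f)).mpr (this.isAlgebraic x)
    obtain ⟨y, hy0, hy⟩ := hx.exists_integral_multiple
    refine ⟨algebraMap F[X] (fieldK f) y, isIntegral_algebraMap, fun h0 => ?_, ?_⟩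
    · have h1 := valuation₁_poly f hy0
      rw [h0, map_zero] at h1
      exact exp_ne_zero h1.symm
    · rwa [← Algebra.smul_def]
  eq_or_eq V hV hT := eq_or_eq_of_liesOverInfty ha hd hb hint hf hfd hσ hσσ
    (liesOverInfty_of_isPlace hV hT)

theorem setOf_liesOverInfty_eq (ha : a.natDegree = d) (hd : 0 < d) (hb : b ≠ 0)
    (hint : IsIntegral (RatFunc F) f)
    (hf : f ^ 2 = algebraMap F[X] (CompletionAtInfty F) a * f
      + algebraMap F[X] (CompletionAtInfty F) (C b)) (hfd : Valued.v f = exp (d : ℤ))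
    (hσ : σ (gen f) = algebraMap F[X] (fieldK f) a - gen f) (hσσ : ∀ x, σ (σ x) = x) :
    {V : ValuationSubring (fieldK f) | LiesOverInfty V} =
      {infty₁ f, (valuation₂ σ).valuationSubring} := by
  ext V
  rw [Set.mem_ofPred_eq, Set.mem_insert_iff, Set.mem_singleton_iff]
  refine ⟨eq_or_eq_of_liesOverInfty ha hd hb hint hf hfd hσ hσσ, ?_⟩
  rintro (rfl | rfl)
  · exact liesOverInfty_iff.mpr fun r => by
      rw [infty₁_eq, Valuation.mem_valuationSubring_iff, valuation₁_algebraMap]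
  · exact liesOverInfty_iff.mpr fun r => by
      rw [Valuation.mem_valuationSubring_iff, valuation₂_algebraMap]

end Conj

/-! ### `O_K` as a localization of `A_{∞₁}`, and its units. -/

section Rings

variable {v₂ : Valuation (fieldK f) ℤᵐ⁰}

theorem isLocalization_away (h : SplitUnit F (valuation₁ f) v₂ (gen f) d) :
    IsLocalization.Away (⟨gen f, h.gen_mem⟩ : A₁ f) (OK f) := by
  have hg0 := h.gen_ne_zero
  refine ⟨?_, ?_, ?_⟩
  · rintro ⟨_, n, rfl⟩
    refine IsUnit.of_mul_eq_one ⟨(gen f)⁻¹ ^ n, h.isIntegral_gen_inv.pow n⟩ (Subtype.ext ?_)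
    change gen f ^ n * (gen f)⁻¹ ^ n = 1
    rw [← mul_pow, mul_inv_cancel₀ hg0, one_pow]
  · intro z
    obtain ⟨n, hn⟩ := h.exists_gen_pow_mul_mem z.2
    refine ⟨⟨⟨_, hn⟩, ⟨_, n, rfl⟩⟩, Subtype.ext ?_⟩
    exact mul_comm (z : fieldK f) (gen f ^ n)
  · intro x y hxy
    exact ⟨1, by rw [Subring.inclusion_injective (A₁_le_OK f) hxy]⟩

theorem exists_eq_add_mul_gen_of_mem_adjoin
    (hf : f ^ 2 = algebraMap F[X] (CompletionAtInfty F) a * f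
      + algebraMap F[X] (CompletionAtInfty F) (C b)) {u : fieldK f}
    (hu : u ∈ Algebra.adjoin F[X] {gen f}) :
    ∃ x y : F[X], u = algebraMap F[X] (fieldK f) x + algebraMap F[X] (fieldK f) y * gen f := by
  induction hu using Algebra.adjoin_induction with
  | mem y hy => exact ⟨0, 1, by rw [Set.mem_singleton_iff.mp hy]; simp⟩
  | algebraMap r => exact ⟨r, 0, by simp⟩
  | add y z _ _ hy hz =>
    obtain ⟨r, s, rfl⟩ := hy
    obtain ⟨t, u, rfl⟩ := hz
    exact ⟨r + t, s + u, by rw [map_add, map_add]; ring⟩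
  | mul y z _ _ hy hz =>
    obtain ⟨r, s, rfl⟩ := hy
    obtain ⟨t, u, rfl⟩ := hz
    refine ⟨r * t + s * u * C b, r * u + s * t + s * u * a, ?_⟩
    simp only [map_add, map_mul]
    linear_combination algebraMap F[X] (fieldK f) s * algebraMap F[X] (fieldK f) u * gen_sq hf

theorem eq_const_mul_zpow_of_isFundamental (hfund : IsFundamental f) {u : fieldK f} (hu0 : u ≠ 0)
    (hu : IsIntegral F[X] u) (hu' : IsIntegral F[X] u⁻¹) :
    ∃ (c : F) (n : ℤ), c ≠ 0 ∧ u = algebraMap F[X] (fieldK f) (C c) * gen f ^ n :=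
  hfund ⟨⟨u, hu⟩, ⟨u⁻¹, hu'⟩, Subtype.ext (mul_inv_cancel₀ hu0),
    Subtype.ext (inv_mul_cancel₀ hu0)⟩

end Rings

end QuadUnit

/-! ### The main theorem. -/

theorem mainTheorem7 {F : Type*} [Field F] [Finite F] [DecidableEq (RatFunc F)]
    (a : F[X]) (b : F) (d : ℕ) (hd : a.natDegree = d) (hd0 : 0 < d) (hb : b ≠ 0)
    (f : CompletionAtInfty F)
    (hf : f ^ 2 = algebraMap F[X] (CompletionAtInfty F) a * f
      + algebraMap F[X] (CompletionAtInfty F) (C b))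
    (hconj : Valued.v (algebraMap F[X] (CompletionAtInfty F) a - f) < Valued.v f) :
    IsPlace F (infty₁ f) ∧ (∀ i < d, gen f * varT f ^ i ∈ A₁ f) ∧
    ∃ (_ : IsDedekindDomain (A₁ f))
      (h𝔞 : idealA f (d - 1) ∈ nonZeroDivisors (Ideal (A₁ f)))
      (infty₂ : ValuationSubring (fieldK f))
      (h₂ : IsPlace F infty₂) (hne : infty₂ ≠ infty₁ f),
      {V : ValuationSubring (fieldK f) | LiesOverInfty V} = {infty₁ f, infty₂} ∧
      (vanishingIdeal h₂ hne).IsMaximal ∧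
      idealA f (d - 1) = vanishingIdeal h₂ hne ∧
      Function.Surjective (inflation f) ∧
      (inflation f).ker = Subgroup.zpowers (ClassGroup.mk0 ⟨idealA f (d - 1), h𝔞⟩) ∧
      (OK f = Algebra.adjoin F[X] {gen f} ∨ IsFundamental f →
        Nat.card (inflation f).ker = d) := by
  have ha0 : a ≠ 0 := by
    rintro rfl
    rw [natDegree_zero] at hd
    omega
  have hfd : Valued.v f = WithZero.exp (d : ℤ) := hd ▸ valued_eq_of_conj_lt hconj ha0
  have hf1 : Valued.v f ≠ 1 := by
    rw [hfd, ← WithZero.exp_zero, Ne, WithZero.exp_inj]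
    omega
  obtain ⟨hint, -⟩ := minpoly_eq hb hf hf1
  obtain ⟨σ, hσ, hσσ⟩ := exists_conj hb hf hf1
  have h : SplitUnit F (valuation₁ f) (valuation₂ σ) (gen f) d :=
    splitUnit hd hd0 hb hint hf hfd hσ hσσ
  have hded : IsDedekindDomain (A₁ f) := h.isDedekindDomain
  have hspan : idealA f (d - 1) = vanishingIdeal (P := infty₁ f) h.isPlace₂ h.valuationSubring_ne :=
    h.span_eq_vanishingIdeal
  have hmem : idealA f (d - 1) ∈ nonZeroDivisors (Ideal (A₁ f)) := by
    rw [mem_nonZeroDivisors_iff_ne_zero, hspan]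
    exact h.vanishingIdeal_ne_bot
  have hloc := isLocalization_away h
  have hs0 : (⟨gen f, h.gen_mem⟩ : A₁ f) ≠ 0 := fun h0 =>
    h.gen_ne_zero (congrArg Subtype.val h0)
  -- `O_K` inherits the Dedekind property as a localization of `A_{∞₁}`.
  have hdedOK : IsDedekindDomain (OK f) := IsLocalization.isDedekindDomain (A₁ f)
    (powers_le_nonZeroDivisors_of_noZeroDivisors hs0) (OK f)
  have hker : (inflation f).ker = Subgroup.zpowers (ClassGroup.mk0 ⟨idealA f (d - 1), hmem⟩) :=
    ClassGroup.ker_extendedHom_of_away (OK f) (s := ⟨gen f, h.gen_mem⟩) hmem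
      (hspan ▸ h.gen_mem_vanishingIdeal)
      (fun Q hQ hgQ => (h.eq_vanishingIdeal_of_isPrime hQ hgQ).trans hspan.symm) hs0
  refine ⟨h.isPlace₁, fun i hi => h.gen_mul_var_pow_mem hi.le, hded, hmem, _, h.isPlace₂,
    h.valuationSubring_ne, setOf_liesOverInfty_eq hd hd0 hb hint hf hfd hσ hσσ,
    h.isMaximal_vanishingIdeal, hspan,
    ClassGroup.extendedHom_surjective_of_isLocalization (A₁ f) (OK f)
      (Submonoid.powers (⟨gen f, h.gen_mem⟩ : A₁ f)), hker, fun hor => ?_⟩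
  have hunits (u : fieldK f) (hu0 : u ≠ 0) (hu : IsIntegral F[X] u) (hu' : IsIntegral F[X] u⁻¹) :
      ∃ (c : F) (n : ℤ), c ≠ 0 ∧ u = algebraMap F[X] (fieldK f) (C c) * gen f ^ n := by
    rcases hor with hadj | hfund
    · refine h.eq_const_mul_zpow (fun w hw => exists_eq_add_mul_gen_of_mem_adjoin hf ?_) hu0 hu hu'
      rw [← hadj]
      exact hw
    · exact eq_const_mul_zpow_of_isFundamental hfund hu0 hu hu'
  rw [hker, Nat.card_zpowers]
  have : IsDedekindDomain (regularOutside F (valuation₁ f).valuationSubring) := hded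
  exact h.orderOf_mk0_vanishingIdeal hspan hmem hunits
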